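/- **Setting.** Alice and Bob have inputs $x,y$ and outputs $a,b$ (outputs from finite sets), and Charlie holds a finite-dimensional quantum system. A (tripartite) *assemblage* is a family $\sigma=\{\sigma_{a,b|x,y}\}$ of positive semidefinite operators on Charlie's space with $\operatorname{Tr}\sum_{a,b}\sigma_{a,b|x,y}=1$ for all $x,y$, such that $\sum_{a,b}\sigma_{a,b|x,y}$ is independent of $(x,y)$, $\sum_a\sigma_{a,b|x,y}$ is independent of $x$, and $\sum_b\sigma_{a,b|x,y}$ is independent of $y$. It is *quantum-realizable* if $\sigma_{a,b|x,y}=\operatorname{Tr}_{AB}[(M_{a|x}\otimes N_{b|y}\otimes\mathbb 1)\varrho]$ for some tripartite state $\varrho$ (finite-dimensional, with Charlie's given space as third factor) and POVMs $\{M_{a|x}\}_a$, $\{N_{b|y}\}_b$. Consider decompositions $$\sigma_{a,b|x,y}=\sum_\lambda P_\lambda\,P_{a,b|x,y,\lambda}\,\varrho_\lambda\qquad(*)$$ with finitely many $\lambda$, a probability distribution $P_\lambda$, states $\varrho_\lambda$ of Charlie, and for each $\lambda$ a conditional probability distribution $\{P_{a,b|x,y,\lambda}\}$. An assemblage is in $\mathsf{LHS}$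 if it has a decomposition $(*)$; in $\mathsf{TO\text{-}LHS}$ if it has a decomposition $(*)$ in which every $\{P_{a,b|x,y,\lambda}\}$ is non-signaling from Bob to Alice and also a (possibly different) decomposition $(*)$ in which every one is non-signaling from Alice to Bob; in $\mathsf{NS\text{-}LHS}$ if it has a decomposition $(*)$ in which every one is non-signaling in both directions; in $\mathsf{Q\text{-}LHS}$ if it has a decomposition $(*)$ in which every one is quantum, $P_{a,b|x,y,\lambda}=\operatorname{Tr}[(M^\lambda_{a|x}\otimes N^\lambda_{b|y})\varrho^{AB}_\lambda]$ for POVMs and a state on finite-dimensional spaces. **Theorem S1.** 1. $\mathsf{Q\text{-}LHS}\subseteq\mathsf{NS\text{-}LHS}\subseteq\mathsf{TO\text{-}LHS}\subseteq\mathsf{LHS}$ for all output sets, input sets and dimensions. For binary inputs and outputs ($a,b,x,y\in\{0,1\}$) and a qubit of Charlie all three inclusions are strict, and they remain strict when each of the four sets is intersected with the set of quantum-realizable assemblages. 2. Let $\sigma^{\mathrm{GHZ}}$ be obtained from $(|000\rangle+|111\rangle)/\sqrt2$ when Alice makes the trivial measurement $\{\mathbb 1/2,\mathbb 1/2\}$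 for $x=0$ and the $X$-basis measurement for $x=1$, and Bob measures $(Z+(-1)^yX)/\sqrt2$. Then $\sigma^{\mathrm{GHZ}}_{a,b|x,y}=\frac18\{\mathbb 1+\frac{(-1)^b}{\sqrt2}[Z+x(-1)^{a+y}X]\}$; this quantum-realizable assemblage is in $\mathsf{LHS}$. The wiring $y=a$ maps it to $\sigma_{b|x}:=\sum_a\sigma^{\mathrm{GHZ}}_{a,b|x,a}=\frac14[\mathbb 1+\frac{(-1)^b}{\sqrt2}(Z+xX)]$, which is steerable, i.e. is not of the form $\sum_\lambda P_\lambda P_{b|x,\lambda}\varrho_\lambda$; and $\sigma^{\mathrm{GHZ}}\notin\mathsf{TO\text{-}LHS}$. 3. Let $\eta=0.97177$ and let $\sigma^{(v)}$ be obtained from the noisy $W$ state $v|W\rangle\langle W|+(1-v)\mathbb 1/8$, $|W\rangle=(|001\rangle+|010\rangle+|100\rangle)/\sqrt3$, $0\le v\le1$, when Alice and Bob both measure $\eta X+\sqrt{1-\eta^2}\,Z$ for input $0$ and $\sqrt{1-\eta^2}\,X-\eta Z$ for input $1$. These assemblages are quantum-realizable, and $\sigma^{(v)}\in\mathsf{TO\text{-}LHS}$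 for $0\le v\le0.64$. There are Hermitian matrices $W_{abxy}$ with $-1\le\sum_{a,b,x,y}\operatorname{Tr}[W_{abxy}\sigma_{a,b|x,y}]\le0$ for every $\sigma\in\mathsf{NS\text{-}LHS}$ (binary inputs and outputs, qubit) and $\sum_{a,b,x,y}\operatorname{Tr}[W_{abxy}\sigma^{(v)}_{a,b|x,y}]>0$ for $0.64\le v\le1$. Hence, for $0.64\le v\le 1$, $\sigma^{(v)}\notin\mathsf{NS\text{-}LHS}$, and $\sigma^{(v)}$ certifies $AB|C$ entanglement: no state of the form $\sum_\lambda P_\lambda\,\varrho^{AB}_\lambda\otimes\varrho^C_\lambda$ yields $\sigma^{(v)}$ under local measurements of Alice and Bob. In particular $\sigma^{(0.64)}$ certifies $AB|C$ entanglement although it is in $\mathsf{TO\text{-}LHS}$, i.e. is unsteerable. -/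

import Mathlib

namespace Steering

open Matrix
open scoped Kronecker ComplexOrder

noncomputable section

/-- A family `σ a b x y` of operators on Charlie's space `ℂ^C`, with outputs `a : A`, `b : B` and
inputs `x : X`, `y : Y` of Alice and Bob. -/
abbrev Family (A B X Y C : Type*) := A → B → X → Y → Matrix C C ℂ

/-- Real numbers `P a b x y`, to be read as `P(a, b | x, y)`. -/
abbrev Box (A B X Y : Type*) := A → B → X → Y → ℝ

/-- Density matrices: positive semidefinite with unit trace. -/
def IsDensity {C : Type*} [Fintype C] (ρ : Matrix C C ℂ) : Prop :=
  ρ.PosSemidef ∧ ρ.trace = 1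

/-- A family of POVMs on `ℂ^D`, one for each input `x : X`, with outcomes in `A`. -/
def IsPOVM {X A D : Type*} [Fintype A] [DecidableEq D]
    (M : X → A → Matrix D D ℂ) : Prop :=
  (∀ x a, (M x a).PosSemidef) ∧ ∀ x, ∑ a, M x a = 1

/-- Tripartite assemblages: subnormalized states of Charlie that are normalized for each pair of
inputs and satisfy the three no-signaling conditions. -/
structure IsAssemblage {A B X Y C : Type*} [Fintype A] [Fintype B] [Fintype C]
    (σ : Family A B X Y C) : Prop where
  posSemidef : ∀ a b x y, (σ a b x y).PosSemidef
  normalized : ∀ x y, (∑ a, ∑ b, σ a b x y).trace = 1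
  noSignaling_AB_C : ∀ x y x' y', ∑ a, ∑ b, σ a b x y = ∑ a, ∑ b, σ a b x' y'
  noSignaling_A : ∀ b y x x', ∑ a, σ a b x y = ∑ a, σ a b x' y
  noSignaling_B : ∀ a x y y', ∑ b, σ a b x y = ∑ b, σ a b x y'

/-- Bipartite behaviors: conditional probability distributions, possibly signaling. -/
def IsBehavior {A B X Y : Type*} [Fintype A] [Fintype B] (P : Box A B X Y) : Prop :=
  (∀ a b x y, 0 ≤ P a b x y) ∧ ∀ x y, ∑ a, ∑ b, P a b x y = 1

/-- No signaling from Bob to Alice: Alice's marginal does not depend on `y`. -/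
def NoSignalingBtoA {A B X Y : Type*} [Fintype B] (P : Box A B X Y) : Prop :=
  ∀ a x y y', ∑ b, P a b x y = ∑ b, P a b x y'

/-- No signaling from Alice to Bob: Bob's marginal does not depend on `x`. -/
def NoSignalingAtoB {A B X Y : Type*} [Fintype A] (P : Box A B X Y) : Prop :=
  ∀ b y x x', ∑ a, P a b x y = ∑ a, P a b x' y

/-- Quantum behaviors: `P(a, b | x, y) = Tr[(M_{a|x} ⊗ N_{b|y}) ρ]` for some local POVMs and some
bipartite state. -/
def IsQuantumBehavior {A B X Y : Type*} [Fintype A] [Fintype B] (P : Box A B X Y) : Prop :=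
  ∃ (dA dB : ℕ) (ρ : Matrix (Fin dA × Fin dB) (Fin dA × Fin dB) ℂ)
    (M : X → A → Matrix (Fin dA) (Fin dA) ℂ) (N : Y → B → Matrix (Fin dB) (Fin dB) ℂ),
    IsDensity ρ ∧ IsPOVM M ∧ IsPOVM N ∧
      ∀ a b x y, (P a b x y : ℂ) = ((M x a ⊗ₖ N y b) * ρ).trace

/-- `σ_{a,b|x,y} = ∑_l p_l P_l(a, b | x, y) ρ_l` for a probability distribution `p`, states `ρ_l`
of Charlie, and behaviors `P_l` that all belong to the class `K`. -/
def HasLHSModel {A B X Y C : Type*} [Fintype A] [Fintype B] [Fintype C]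
    (K : Box A B X Y → Prop) (σ : Family A B X Y C) : Prop :=
  ∃ (n : ℕ) (p : Fin n → ℝ) (P : Fin n → Box A B X Y) (ρ : Fin n → Matrix C C ℂ),
    (∀ l, 0 ≤ p l) ∧ ∑ l, p l = 1 ∧
    (∀ l, IsBehavior (P l) ∧ K (P l)) ∧ (∀ l, IsDensity (ρ l)) ∧
    ∀ a b x y, σ a b x y = ∑ l, (p l * P l a b x y) • ρ l

section Sets

variable (A B X Y C : Type*) [Fintype A] [Fintype B] [Fintype C]

/-- Assemblages with a local-hidden-state model across `AB|C`, with arbitrary behaviors. -/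
def LHS : Set (Family A B X Y C) :=
  {σ | IsAssemblage σ ∧ HasLHSModel (fun _ => True) σ}

/-- Assemblages with time-ordered local-hidden-state models for both orders. -/
def TOLHS : Set (Family A B X Y C) :=
  {σ | IsAssemblage σ ∧ HasLHSModel NoSignalingBtoA σ ∧ HasLHSModel NoSignalingAtoB σ}

/-- Assemblages with a local-hidden-state model whose behaviors are all non-signaling. -/
def NSLHS : Set (Family A B X Y C) :=
  {σ | IsAssemblage σ ∧ HasLHSModel (fun P => NoSignalingBtoA P ∧ NoSignalingAtoB P) σ}

/-- Assemblages with a local-hidden-state model whose behaviors are all quantum. -/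
def QLHS : Set (Family A B X Y C) :=
  {σ | IsAssemblage σ ∧ HasLHSModel IsQuantumBehavior σ}

end Sets

/-- The partial trace over the first tensor factor. -/
def partialTraceLeft {D C : Type*} [Fintype D] (T : Matrix (D × C) (D × C) ℂ) : Matrix C C ℂ :=
  fun c c' => ∑ d, T (d, c) (d, c')

/-- The family `Tr_{AB}[(M_{a|x} ⊗ N_{b|y} ⊗ 1) ρ]` that Alice and Bob prepare for Charlie by
measuring their shares of the tripartite state `ρ`. -/
def measured {A B X Y C α β : Type*} [Fintype α] [Fintype β] [Fintype C] [DecidableEq C]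
    (M : X → A → Matrix α α ℂ) (N : Y → B → Matrix β β ℂ)
    (ρ : Matrix ((α × β) × C) ((α × β) × C) ℂ) : Family A B X Y C :=
  fun a b x y => partialTraceLeft (((M x a ⊗ₖ N y b) ⊗ₖ (1 : Matrix C C ℂ)) * ρ)

/-- The quantum-realizable assemblages. -/
def QuantumRealizable (A B X Y C : Type*) [Fintype A] [Fintype B] [Fintype C] [DecidableEq C] :
    Set (Family A B X Y C) :=
  {σ | ∃ (dA dB : ℕ) (ρ : Matrix ((Fin dA × Fin dB) × C) ((Fin dA × Fin dB) × C) ℂ)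
    (M : X → A → Matrix (Fin dA) (Fin dA) ℂ) (N : Y → B → Matrix (Fin dB) (Fin dB) ℂ),
    IsDensity ρ ∧ IsPOVM M ∧ IsPOVM N ∧ σ = measured M N ρ}

/-- Tripartite states that are separable across `AB|C`; the states of `AB` may be entangled. -/
def IsSeparableABC {α β C : Type*} [Fintype α] [Fintype β] [Fintype C]
    (ρ : Matrix ((α × β) × C) ((α × β) × C) ℂ) : Prop :=
  ∃ (n : ℕ) (p : Fin n → ℝ) (ρAB : Fin n → Matrix (α × β) (α × β) ℂ)
    (ρC : Fin n → Matrix C C ℂ),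
    (∀ l, 0 ≤ p l) ∧ ∑ l, p l = 1 ∧ (∀ l, IsDensity (ρAB l)) ∧ (∀ l, IsDensity (ρC l)) ∧
    ρ = ∑ l, p l • (ρAB l ⊗ₖ ρC l)

/-- `σ` certifies `AB|C` entanglement: no quantum realization of `σ` by local measurements of
Alice and Bob uses a state that is separable across `AB|C`. -/
def CertifiesEntanglement {A B X Y C : Type*} [Fintype A] [Fintype B] [Fintype C]
    [DecidableEq C] (σ : Family A B X Y C) : Prop :=
  ∀ (dA dB : ℕ) (ρ : Matrix ((Fin dA × Fin dB) × C) ((Fin dA × Fin dB) × C) ℂ)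
    (M : X → A → Matrix (Fin dA) (Fin dA) ℂ) (N : Y → B → Matrix (Fin dB) (Fin dB) ℂ),
    IsDensity ρ → IsPOVM M → IsPOVM N → σ = measured M N ρ → ¬ IsSeparableABC ρ

/-- The wiring `y = a`, which turns a tripartite assemblage into a bipartite one. -/
def wired {A B X C : Type*} [Fintype A] (σ : Family A B X A C) : B → X → Matrix C C ℂ :=
  fun b x => ∑ a, σ a b x a

/-- Bipartite steerability: there is no local-hidden-state model
`τ_{b|x} = ∑_l p_l Q_l(b | x) ρ_l`. -/
def IsSteerable {B X C : Type*} [Fintype B] [Fintype C] (τ : B → X → Matrix C C ℂ) : Prop :=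
  ¬ ∃ (n : ℕ) (p : Fin n → ℝ) (Q : Fin n → B → X → ℝ) (ρ : Fin n → Matrix C C ℂ),
    (∀ l, 0 ≤ p l) ∧ ∑ l, p l = 1 ∧
    (∀ l b x, 0 ≤ Q l b x) ∧ (∀ l x, ∑ b, Q l b x = 1) ∧ (∀ l, IsDensity (ρ l)) ∧
    ∀ b x, τ b x = ∑ l, (p l * Q l b x) • ρ l

/-- The linear functional `∑ Tr[W_{abxy} σ_{a,b|x,y}]`; it is real when `W` and `σ` are
Hermitian. -/
def witnessValue {A B X Y C : Type*} [Fintype A] [Fintype B] [Fintype X] [Fintype Y] [Fintype C]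
    (W σ : Family A B X Y C) : ℝ :=
  ∑ a, ∑ b, ∑ x, ∑ y, (W a b x y * σ a b x y).trace.re

/-- The Pauli matrix `X`. -/
def pauliX : Matrix (Fin 2) (Fin 2) ℂ := !![0, 1; 1, 0]

/-- The Pauli matrix `Z`. -/
def pauliZ : Matrix (Fin 2) (Fin 2) ℂ := !![1, 0; 0, -1]

/-- The spectral projections `(1 + (-1)^a O) / 2` of an observable `O` with `O ^ 2 = 1`. -/
def dichotomic (O : Matrix (Fin 2) (Fin 2) ℂ) (a : Fin 2) : Matrix (Fin 2) (Fin 2) ℂ :=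
  (1 / 2 : ℝ) • (1 + ((-1 : ℝ) ^ (a : ℕ)) • O)

/-- The three-qubit space `(ℂ² ⊗ ℂ²) ⊗ ℂ²` of Alice, Bob and Charlie. -/
abbrev Qubits := (Fin 2 × Fin 2) × Fin 2

/-- The vector `(|000⟩ + |111⟩) / √2`. -/
def ghzVec : Qubits → ℂ :=
  fun q => if q.1.1 = q.1.2 ∧ q.1.2 = q.2 then ((1 / √2 : ℝ) : ℂ) else 0

/-- The vector `(|001⟩ + |010⟩ + |100⟩) / √3`. -/
def wVec : Qubits → ℂ :=
  fun q => if (q.1.1 : ℕ) + (q.1.2 : ℕ) + (q.2 : ℕ) = 1 then ((1 / √3 : ℝ) : ℂ) else 0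

/-- The GHZ state. -/
def ghzState : Matrix Qubits Qubits ℂ := vecMulVec ghzVec (star ghzVec)

/-- The noisy W state with visibility `v`. -/
def noisyWState (v : ℝ) : Matrix Qubits Qubits ℂ :=
  v • vecMulVec wVec (star wVec) + ((1 - v) / 8) • (1 : Matrix Qubits Qubits ℂ)

/-- Alice's measurements on the GHZ state: trivial for `x = 0`, in the `X` basis for `x = 1`. -/
def ghzMeasA (x a : Fin 2) : Matrix (Fin 2) (Fin 2) ℂ :=
  if x = 0 then (1 / 2 : ℝ) • 1 else dichotomic pauliX a

/-- Bob's measurements on the GHZ state: in the `Z + X` basis for `y = 0` and in the `Z - X` basis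
for `y = 1`. -/
def ghzMeasB (y b : Fin 2) : Matrix (Fin 2) (Fin 2) ℂ :=
  dichotomic ((1 / √2) • (pauliZ + ((-1 : ℝ) ^ (y : ℕ)) • pauliX)) b

/-- The measurements of Alice and of Bob on the noisy W state, in the bases of
`η X + √(1 - η²) Z` for input `0` and of `√(1 - η²) X - η Z` for input `1`. -/
def wMeas (η : ℝ) (x a : Fin 2) : Matrix (Fin 2) (Fin 2) ℂ :=
  dichotomic (if x = 0 then η • pauliX + √(1 - η ^ 2) • pauliZ
    else √(1 - η ^ 2) • pauliX - η • pauliZ) a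

/-- The assemblage obtained from the GHZ state. -/
def ghzAssemblage : Family (Fin 2) (Fin 2) (Fin 2) (Fin 2) (Fin 2) :=
  measured ghzMeasA ghzMeasB ghzState

/-- The assemblage obtained from the noisy W state with visibility `v`. -/
def noisyWAssemblage (η v : ℝ) : Family (Fin 2) (Fin 2) (Fin 2) (Fin 2) (Fin 2) :=
  measured (wMeas η) (wMeas η) (noisyWState v)

end

end Steering

namespace Steering

open Matrix
open scoped Kronecker ComplexOrder MatrixOrder

noncomputable section

/-! ### Positive semidefinite matrices and partial traces -/

section General

/-! The inclusions come from one observation: summing a POVM gives the identity, so quantum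
behaviors are non-signaling. Strictness needs three separating examples. Each is obtained by local
measurements on a three-qubit state, so the same examples settle strictness among all assemblages
and among the quantum-realizable ones. All matrices involved are real, so Charlie's hidden state
enters the witnesses only through its Bloch components along X and Z, a point of the unit disc.

NS-LHS but not Q-LHS: for a hidden state with Bloch components `(c, s)`, the Mermin-type witness
reduces to `c (E₀₀ - E₁₁) + s (E₀₁ + E₁₀)`. A sum of squares bounds it by 2 for quantum behaviors
(`quantum_correlator_bound`), whereas PR boxes reach `2 (|c| + |s|)`, up to `2√2`. A noisy
stabilizer state attains `4 · 7/10 = 2.8`, between the two bounds, and has an explicit model with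
four PR boxes.

LHS but not TO-LHS: a model without signaling from Bob to Alice survives the wiring `y = a` and
becomes a bipartite hidden-state model (`not_isSteerable_wired`). The wired GHZ assemblage has none:
for `x = 1` its conditional states are pure, which fixes the hidden states, and these cannot
reproduce `x = 0`.

TO-LHS but not NS-LHS: at visibility 0.64 the W assemblage has an explicit model with sixteen
deterministic strategies in which Alice acts first; the symmetry between Alice and Bob gives the
other order, and white noise gives smaller visibilities. Against NS-LHS there is a linear witness.
Its bound has to be checked only at the extremal non-signaling behaviors, 16 deterministic ones and
8 PR boxes (`functionalValue_nonpos`), and at each of them it is a cone condition on the Bloch disc.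
Entanglement certification follows because a realization by an `AB|C`-separable state yields a Q-LHS
model. -/

lemma posSemidef_smul {D : Type*} {Q : Matrix D D ℂ} (hQ : Q.PosSemidef) {r : ℝ} (hr : 0 ≤ r) :
    (r • Q).PosSemidef := by
  have h := hQ.smul (a := (r : ℂ)) (by exact_mod_cast hr)
  have e : ((r : ℂ) • Q) = r • Q := by
    ext i j
    simp
  rwa [e] at h

variable {D C : Type*} [Fintype D] [Fintype C]

lemma exists_conjTranspose_mul_self {Q : Matrix D D ℂ} (hQ : Q.PosSemidef) :
    ∃ K : Matrix D D ℂ, Q = Kᴴ * K := by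
  classical
  obtain ⟨K, hK⟩ := CStarAlgebra.nonneg_iff_eq_star_mul_self.mp hQ.nonneg
  exact ⟨K, hK⟩

lemma trace_mul_nonneg {Q R : Matrix D D ℂ} (hQ : Q.PosSemidef) (hR : R.PosSemidef) :
    0 ≤ (Q * R).trace := by
  obtain ⟨K, rfl⟩ := exists_conjTranspose_mul_self hQ
  rw [Matrix.mul_assoc, Matrix.trace_mul_comm]
  exact (hR.mul_mul_conjTranspose_same K).trace_nonneg

lemma posSemidef_partialTraceLeft {D C : Type*} [Fintype D] {T : Matrix (D × C) (D × C) ℂ}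
    (hT : T.PosSemidef) : (partialTraceLeft T).PosSemidef := by
  have h : partialTraceLeft T = ∑ d, T.submatrix (fun c => (d, c)) (fun c => (d, c)) := by
    ext c c'
    simp [partialTraceLeft, Matrix.sum_apply]
  rw [h]
  exact posSemidef_sum _ fun d _ => hT.submatrix _

lemma trace_partialTraceLeft (T : Matrix (D × C) (D × C) ℂ) :
    (partialTraceLeft T).trace = T.trace := by
  simp only [Matrix.trace, partialTraceLeft, Matrix.diag_apply, Fintype.sum_prod_type]
  exact Finset.sum_comm

variable [DecidableEq C]

lemma partialTraceLeft_kronecker_one_mul (Q : Matrix D D ℂ) (T : Matrix (D × C) (D × C) ℂ)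
    (c c' : C) :
    partialTraceLeft ((Q ⊗ₖ (1 : Matrix C C ℂ)) * T) c c' =
      ∑ d, ∑ d', Q d d' * T (d', c) (d, c') := by
  simp only [partialTraceLeft, Matrix.mul_apply, kroneckerMap_apply, Fintype.sum_prod_type]
  simp [Matrix.one_apply]

lemma partialTraceLeft_mul_kronecker_one (Q : Matrix D D ℂ) (T : Matrix (D × C) (D × C) ℂ)
    (c c' : C) :
    partialTraceLeft (T * (Q ⊗ₖ (1 : Matrix C C ℂ))) c c' =
      ∑ d, ∑ d', T (d, c) (d', c') * Q d' d := by
  simp only [partialTraceLeft, Matrix.mul_apply, kroneckerMap_apply, Fintype.sum_prod_type]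
  simp [Matrix.one_apply]

/-- The partial trace is cyclic for operators that act on the traced factor alone. This lets half of
a positive operator move to the other side of a state. -/
lemma partialTraceLeft_comm (Q : Matrix D D ℂ) (T : Matrix (D × C) (D × C) ℂ) :
    partialTraceLeft ((Q ⊗ₖ (1 : Matrix C C ℂ)) * T) =
      partialTraceLeft (T * (Q ⊗ₖ (1 : Matrix C C ℂ))) := by
  ext c c'
  rw [partialTraceLeft_kronecker_one_mul, partialTraceLeft_mul_kronecker_one, Finset.sum_comm]
  simp only [mul_comm]

lemma posSemidef_partialTraceLeft_kronecker_one_mul {Q : Matrix D D ℂ} (hQ : Q.PosSemidef)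
    {T : Matrix (D × C) (D × C) ℂ} (hT : T.PosSemidef) :
    (partialTraceLeft ((Q ⊗ₖ (1 : Matrix C C ℂ)) * T)).PosSemidef := by
  obtain ⟨K, rfl⟩ := exists_conjTranspose_mul_self hQ
  have h : (Kᴴ * K) ⊗ₖ (1 : Matrix C C ℂ) =
      (Kᴴ ⊗ₖ (1 : Matrix C C ℂ)) * (K ⊗ₖ (1 : Matrix C C ℂ)) := by
    rw [← mul_kronecker_mul, Matrix.one_mul]
  have h' : Kᴴ ⊗ₖ (1 : Matrix C C ℂ) = (K ⊗ₖ (1 : Matrix C C ℂ))ᴴ := by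
    rw [conjTranspose_kronecker, conjTranspose_one]
  rw [h, Matrix.mul_assoc, partialTraceLeft_comm, h']
  exact posSemidef_partialTraceLeft (hT.mul_mul_conjTranspose_same _)

end General

/-! ### Measured assemblages -/

section Measured

variable {A B X Y C α β : Type*} [Fintype α] [Fintype β] [Fintype C] [DecidableEq C]

lemma measured_apply (M : X → A → Matrix α α ℂ) (N : Y → B → Matrix β β ℂ)
    (ρ : Matrix ((α × β) × C) ((α × β) × C) ℂ) (a : A) (b : B) (x : X) (y : Y) (c c' : C) :
    measured M N ρ a b x y c c' =
      ∑ i, ∑ j, ∑ i', ∑ j', M x a i i' * N y b j j' * ρ ((i', j'), c) ((i, j), c') := by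
  rw [measured, partialTraceLeft_kronecker_one_mul]
  simp only [Fintype.sum_prod_type, kroneckerMap_apply]

lemma measured_add (M : X → A → Matrix α α ℂ) (N : Y → B → Matrix β β ℂ)
    (ρ ρ' : Matrix ((α × β) × C) ((α × β) × C) ℂ) (a : A) (b : B) (x : X) (y : Y) :
    measured M N (ρ + ρ') a b x y = measured M N ρ a b x y + measured M N ρ' a b x y := by
  ext c c'
  simp only [measured_apply, Matrix.add_apply, mul_add, Finset.sum_add_distrib]

lemma measured_smul (M : X → A → Matrix α α ℂ) (N : Y → B → Matrix β β ℂ) (r : ℝ)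
    (ρ : Matrix ((α × β) × C) ((α × β) × C) ℂ) (a : A) (b : B) (x : X) (y : Y) :
    measured M N (r • ρ) a b x y = r • measured M N ρ a b x y := by
  ext c c'
  simp only [measured_apply, Matrix.smul_apply, mul_smul_comm, Finset.smul_sum]

lemma measured_one [DecidableEq α] [DecidableEq β] (M : X → A → Matrix α α ℂ)
    (N : Y → B → Matrix β β ℂ) (a : A) (b : B) (x : X) (y : Y) :
    measured M N (1 : Matrix ((α × β) × C) ((α × β) × C) ℂ) a b x y =
      ((M x a).trace * (N y b).trace) • 1 := by
  ext c c'
  rw [measured, partialTraceLeft_kronecker_one_mul]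
  by_cases h : c = c'
  · simp [Matrix.one_apply, h, Fintype.sum_prod_type, Matrix.trace, Finset.sum_mul_sum]
  · simp [h]

variable {M : X → A → Matrix α α ℂ} {N : Y → B → Matrix β β ℂ}
  {ρ : Matrix ((α × β) × C) ((α × β) × C) ℂ}

lemma sum_measured_left [Fintype A] [DecidableEq α] (hM : IsPOVM M) (b : B) (x : X) (y : Y) :
    ∑ a, measured M N ρ a b x y =
      partialTraceLeft ((((1 : Matrix α α ℂ) ⊗ₖ N y b) ⊗ₖ (1 : Matrix C C ℂ)) * ρ) := by
  ext c c'
  rw [← hM.2 x]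
  simp only [Matrix.sum_apply, measured, partialTraceLeft_kronecker_one_mul, kroneckerMap_apply,
    Finset.sum_mul]
  rw [Finset.sum_comm]
  exact Finset.sum_congr rfl fun _ _ => Finset.sum_comm

lemma sum_measured_right [Fintype B] [DecidableEq β] (hN : IsPOVM N) (a : A) (x : X) (y : Y) :
    ∑ b, measured M N ρ a b x y =
      partialTraceLeft (((M x a ⊗ₖ (1 : Matrix β β ℂ)) ⊗ₖ (1 : Matrix C C ℂ)) * ρ) := by
  ext c c'
  rw [← hN.2 y]
  simp only [Matrix.sum_apply, measured, partialTraceLeft_kronecker_one_mul, kroneckerMap_apply,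
    Finset.mul_sum, Finset.sum_mul]
  rw [Finset.sum_comm]
  exact Finset.sum_congr rfl fun _ _ => Finset.sum_comm

variable [Fintype A] [Fintype B] [DecidableEq α] [DecidableEq β]

lemma sum_measured (hM : IsPOVM M) (hN : IsPOVM N) (x : X) (y : Y) :
    ∑ a, ∑ b, measured M N ρ a b x y = partialTraceLeft ρ := by
  have h : partialTraceLeft ρ = partialTraceLeft
      ((((∑ a, M x a) ⊗ₖ (1 : Matrix β β ℂ)) ⊗ₖ (1 : Matrix C C ℂ)) * ρ) := by
    rw [hM.2 x]
    simp
  rw [h, Finset.sum_congr rfl fun a _ => sum_measured_right hN a x y]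
  ext c c'
  simp only [Matrix.sum_apply, partialTraceLeft_kronecker_one_mul, kroneckerMap_apply,
    Finset.sum_mul]
  rw [Finset.sum_comm]
  exact Finset.sum_congr rfl fun _ _ => Finset.sum_comm

lemma isAssemblage_measured (hρ : IsDensity ρ) (hM : IsPOVM M) (hN : IsPOVM N) :
    IsAssemblage (measured M N ρ) where
  posSemidef a b x y :=
    posSemidef_partialTraceLeft_kronecker_one_mul ((hM.1 x a).kronecker (hN.1 y b)) hρ.1
  normalized x y := by rw [sum_measured hM hN, trace_partialTraceLeft, hρ.2]
  noSignaling_AB_C x y x' y' := by rw [sum_measured hM hN, sum_measured hM hN]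
  noSignaling_A b y x x' := by rw [sum_measured_left hM, sum_measured_left hM]
  noSignaling_B a x y y' := by rw [sum_measured_right hN, sum_measured_right hN]

end Measured

lemma isAssemblage_of_mem_quantumRealizable {A B X Y C : Type*} [Fintype A] [Fintype B]
    [Fintype C] [DecidableEq C] {σ : Family A B X Y C}
    (h : σ ∈ QuantumRealizable A B X Y C) : IsAssemblage σ := by
  obtain ⟨dA, dB, ρ, M, N, hρ, hM, hN, rfl⟩ := h
  exact isAssemblage_measured hρ hM hN

/-! ### Hidden-state models -/

section Models

variable {A B X Y C : Type*} [Fintype A] [Fintype B] [Fintype C]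

lemma HasLHSModel.mono {K K' : Box A B X Y → Prop} (h : ∀ P, IsBehavior P → K P → K' P)
    {σ : Family A B X Y C} (hσ : HasLHSModel K σ) : HasLHSModel K' σ := by
  obtain ⟨n, p, P, ρ, hp, hs, hP, hρ, e⟩ := hσ
  exact ⟨n, p, P, ρ, hp, hs, fun l => ⟨(hP l).1, h _ (hP l).1 (hP l).2⟩, hρ, e⟩

lemma HasLHSModel.of_fintype {K : Box A B X Y → Prop} {σ : Family A B X Y C} {ι : Type*}
    [Fintype ι] (p : ι → ℝ) (P : ι → Box A B X Y) (ρ : ι → Matrix C C ℂ)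
    (hp : ∀ l, 0 ≤ p l) (hs : ∑ l, p l = 1) (hP : ∀ l, IsBehavior (P l) ∧ K (P l))
    (hρ : ∀ l, IsDensity (ρ l)) (e : ∀ a b x y, σ a b x y = ∑ l, (p l * P l a b x y) • ρ l) :
    HasLHSModel K σ := by
  let f := (Fintype.equivFin ι).symm
  refine ⟨Fintype.card ι, p ∘ f, P ∘ f, ρ ∘ f, fun l => hp _, ?_, fun l => hP _, fun l => hρ _,
    fun a b x y => ?_⟩
  · rw [← hs]
    exact f.sum_comp p
  · rw [e]
    exact (f.sum_comp fun l => (p l * P l a b x y) • ρ l).symm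

/-- A model may be given by unnormalized hidden states. -/
lemma HasLHSModel.of_unnormalized {K : Box A B X Y → Prop} {σ : Family A B X Y C} {ι : Type*}
    [Fintype ι] (P : ι → Box A B X Y) (ω : ι → Matrix C C ℂ)
    (hP : ∀ l, IsBehavior (P l) ∧ K (P l)) (hω : ∀ l, (ω l).PosSemidef)
    (hs : ∑ l, (ω l).trace = 1) (e : ∀ a b x y, σ a b x y = ∑ l, P l a b x y • ω l) :
    HasLHSModel K σ := by
  classical
  have htr : ∀ l, (ω l).trace = (((ω l).trace.re : ℝ) : ℂ) := fun l => by
    have h := (Complex.le_def.1 (hω l).trace_nonneg).2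
    apply Complex.ext <;> simp_all
  have hnn : ∀ l, 0 ≤ (ω l).trace.re := fun l => (Complex.le_def.1 (hω l).trace_nonneg).1
  have hdens : ∀ l, (ω l).trace ≠ 0 → IsDensity ((ω l).trace.re⁻¹ • ω l) := fun l hl => by
    refine ⟨posSemidef_smul (hω l) (inv_nonneg.2 (hnn l)), ?_⟩
    rw [Matrix.trace_smul]
    have h0 : (ω l).trace.re ≠ 0 := fun h => hl (by rw [htr l, h, Complex.ofReal_zero])
    rw [htr l, Complex.real_smul, ← Complex.ofReal_mul]
    simp [h0]
  -- A model needs genuine density matrices even at weight zero. Vanishing hidden states are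
  -- therefore replaced by the normalization of a fixed nonzero one, which exists since the traces
  -- sum to 1.
  obtain ⟨l₀, hl₀⟩ : ∃ l, (ω l).trace ≠ 0 := by
    by_contra! h
    simp [h] at hs
  refine HasLHSModel.of_fintype (fun l => (ω l).trace.re) P
    (fun l => if (ω l).trace = 0 then (ω l₀).trace.re⁻¹ • ω l₀ else (ω l).trace.re⁻¹ • ω l)
    hnn ?_ hP (fun l => ?_) fun a b x y => ?_
  · have := congrArg Complex.re hs
    simpa [Complex.re_sum] using this
  · split_ifs with h
    · exact hdens _ hl₀
    · exact hdens _ h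
  · rw [e]
    refine Finset.sum_congr rfl fun l _ => ?_
    split_ifs with h
    · rw [(hω l).trace_eq_zero_iff.1 h]
      simp
    · have h0 : (ω l).trace.re ≠ 0 := fun h' => h (by rw [htr l, h', Complex.ofReal_zero])
      rw [smul_smul]
      congr 1
      field_simp

/-- Exchanging the roles of Alice and Bob. -/
lemma HasLHSModel.swap {σ : Family A B X Y C} (h : HasLHSModel NoSignalingBtoA σ) :
    HasLHSModel NoSignalingAtoB (fun b a y x => σ a b x y) := by
  obtain ⟨n, p, P, ρ, hp, hs, hP, hρ, e⟩ := h
  refine ⟨n, p, fun l b a y x => P l a b x y, ρ, hp, hs, fun l => ⟨⟨?_, ?_⟩, ?_⟩, hρ, ?_⟩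
  · intro b a y x
    exact (hP l).1.1 a b x y
  · intro y x
    rw [Finset.sum_comm]
    exact (hP l).1.2 x y
  · intro a x y y'
    exact (hP l).2 a x y y'
  · intro b a y x
    exact e a b x y

/-- Summing one party's POVM over its outcomes leaves the identity, and the resulting formula for
the other party's marginal no longer mentions the first party's input. -/
lemma isQuantumBehavior_noSignaling {P : Box A B X Y} (h : IsQuantumBehavior P) :
    NoSignalingBtoA P ∧ NoSignalingAtoB P := by
  obtain ⟨dA, dB, ρ, M, N, hρ, hM, hN, e⟩ := h
  constructor
  · have key : ∀ a x y, ((∑ b, P a b x y : ℝ) : ℂ) = ((M x a ⊗ₖ (1 : Matrix _ _ ℂ)) * ρ).trace := by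
      intro a x y
      rw [← hN.2 y]
      push_cast
      simp only [e, ← Matrix.trace_sum, ← Finset.sum_mul]
      congr 2
      ext i j
      simp [Matrix.sum_apply, Finset.mul_sum]
    intro a x y y'
    have := (key a x y).trans (key a x y').symm
    exact_mod_cast this
  · have key : ∀ b x y, ((∑ a, P a b x y : ℝ) : ℂ) = (((1 : Matrix _ _ ℂ) ⊗ₖ N y b) * ρ).trace := by
      intro b x y
      rw [← hM.2 x]
      push_cast
      simp only [e, ← Matrix.trace_sum, ← Finset.sum_mul]
      congr 2
      ext i j
      simp [Matrix.sum_apply, Finset.sum_mul]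
    intro b y x x'
    have := (key b x y).trans (key b x' y).symm
    exact_mod_cast this

lemma QLHS_subset_NSLHS : QLHS A B X Y C ⊆ NSLHS A B X Y C := fun _ h =>
  ⟨h.1, h.2.mono fun _ _ => isQuantumBehavior_noSignaling⟩

lemma NSLHS_subset_TOLHS : NSLHS A B X Y C ⊆ TOLHS A B X Y C := fun _ h =>
  ⟨h.1, h.2.mono fun _ _ => And.left, h.2.mono fun _ _ => And.right⟩

lemma TOLHS_subset_LHS : TOLHS A B X Y C ⊆ LHS A B X Y C := fun _ h =>
  ⟨h.1, h.2.1.mono fun _ _ _ => trivial⟩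

lemma witnessValue_eq_sum [Fintype X] [Fintype Y] (W : Family A B X Y C) {σ : Family A B X Y C}
    {n : ℕ} {p : Fin n → ℝ} {P : Fin n → Box A B X Y} {ρ : Fin n → Matrix C C ℂ}
    (e : ∀ a b x y, σ a b x y = ∑ l, (p l * P l a b x y) • ρ l) :
    witnessValue W σ =
      ∑ l, p l * ∑ a, ∑ b, ∑ x, ∑ y, P l a b x y * (W a b x y * ρ l).trace.re := by
  simp only [witnessValue, e, Matrix.trace_sum, Complex.re_sum, Matrix.mul_smul,
    Matrix.trace_smul, Complex.real_smul, Complex.re_ofReal_mul, mul_assoc, Finset.mul_sum]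
  have h1 : ∀ a b x, ∑ y, ∑ l, p l * (P l a b x y * (W a b x y * ρ l).trace.re) =
      ∑ l, ∑ y, p l * (P l a b x y * (W a b x y * ρ l).trace.re) :=
    fun a b x => Finset.sum_comm
  have h2 : ∀ a b, ∑ x, ∑ l, ∑ y, p l * (P l a b x y * (W a b x y * ρ l).trace.re) =
      ∑ l, ∑ x, ∑ y, p l * (P l a b x y * (W a b x y * ρ l).trace.re) :=
    fun a b => Finset.sum_comm
  have h3 : ∀ a, ∑ b, ∑ l, ∑ x, ∑ y, p l * (P l a b x y * (W a b x y * ρ l).trace.re) =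
      ∑ l, ∑ b, ∑ x, ∑ y, p l * (P l a b x y * (W a b x y * ρ l).trace.re) :=
    fun a => Finset.sum_comm
  simp only [h1, h2, h3]
  exact Finset.sum_comm

/-- A bound on a witness over product strategies extends to all hidden-state models. -/
lemma witnessValue_mem_Icc [Fintype X] [Fintype Y] {K : Box A B X Y → Prop}
    {W σ : Family A B X Y C} (hσ : HasLHSModel K σ) {s t : ℝ}
    (h : ∀ P, IsBehavior P → K P → ∀ ρ, IsDensity ρ →
      ∑ a, ∑ b, ∑ x, ∑ y, P a b x y * (W a b x y * ρ).trace.re ∈ Set.Icc s t) :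
    witnessValue W σ ∈ Set.Icc s t := by
  obtain ⟨n, p, P, ρ, hp, hs, hP, hρ, e⟩ := hσ
  rw [witnessValue_eq_sum W e]
  have h' := fun l => h (P l) (hP l).1 (hP l).2 (ρ l) (hρ l)
  have hc : ∀ c : ℝ, ∑ l, p l * c = c := fun c => by rw [← Finset.sum_mul, hs, one_mul]
  constructor
  · rw [← hc s]
    exact Finset.sum_le_sum fun l _ => mul_le_mul_of_nonneg_left (h' l).1 (hp l)
  · rw [← hc t]
    exact Finset.sum_le_sum fun l _ => mul_le_mul_of_nonneg_left (h' l).2 (hp l)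

end Models

/-- Local measurements on a state that is separable across `AB|C` give an assemblage with a
quantum hidden-state model. -/
lemma measured_mem_QLHS_of_isSeparableABC {A B X Y C : Type*} [Fintype A] [Fintype B] [Fintype C]
    [DecidableEq C] {dA dB : ℕ}
    {ρ : Matrix ((Fin dA × Fin dB) × C) ((Fin dA × Fin dB) × C) ℂ}
    {M : X → A → Matrix (Fin dA) (Fin dA) ℂ} {N : Y → B → Matrix (Fin dB) (Fin dB) ℂ}
    (hρ : IsDensity ρ) (hM : IsPOVM M) (hN : IsPOVM N) (h : IsSeparableABC ρ) :
    measured M N ρ ∈ QLHS A B X Y C := by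
  refine ⟨isAssemblage_measured hρ hM hN, ?_⟩
  obtain ⟨n, p, ρAB, ρC, hp, hs, hAB, hC, rfl⟩ := h
  have hnn : ∀ l a b x y, 0 ≤ ((M x a ⊗ₖ N y b) * ρAB l).trace := fun l a b x y =>
    trace_mul_nonneg ((hM.1 x a).kronecker (hN.1 y b)) (hAB l).1
  have hre : ∀ l a b x y, ((((M x a ⊗ₖ N y b) * ρAB l).trace.re : ℝ) : ℂ) =
      ((M x a ⊗ₖ N y b) * ρAB l).trace := fun l a b x y => by
    have h := (Complex.le_def.1 (hnn l a b x y)).2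
    apply Complex.ext <;> simp_all
  -- The same measurements on the `AB` part of the `l`-th product term give the `l`-th behavior; its
  -- `C` part is the hidden state.
  refine ⟨n, p, fun l a b x y => ((M x a ⊗ₖ N y b) * ρAB l).trace.re, ρC, hp, hs,
    fun l => ⟨⟨fun a b x y => (Complex.le_def.1 (hnn l a b x y)).1, fun x y => ?_⟩,
      dA, dB, ρAB l, M, N, hAB l, hM, hN, fun a b x y => hre l a b x y⟩, hC, fun a b x y => ?_⟩
  · have h1 : ∑ a, ∑ b, ((M x a ⊗ₖ N y b) * ρAB l).trace = 1 := by
      have h2 : ∑ a, ∑ b, M x a ⊗ₖ N y b = 1 := by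
        rw [← one_kronecker_one, ← hM.2 x, ← hN.2 y]
        ext i j
        simp [Matrix.sum_apply, Finset.sum_mul_sum]
      simp only [← Matrix.trace_sum, ← Finset.sum_mul]
      rw [h2, Matrix.one_mul, (hAB l).2]
    have := congrArg Complex.re h1
    simpa [Complex.re_sum] using this
  · ext c c'
    have e1 : ∀ l, ∑ d, ∑ d', (M x a ⊗ₖ N y b) d d' * (ρAB l ⊗ₖ ρC l) (d', c) (d, c') =
        ((M x a ⊗ₖ N y b) * ρAB l).trace * ρC l c c' := fun l => by
      simp only [kroneckerMap_apply, Matrix.trace, Matrix.diag_apply, Matrix.mul_apply,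
        Finset.sum_mul, mul_assoc]
    rw [measured, partialTraceLeft_kronecker_one_mul]
    simp only [Matrix.sum_apply, Matrix.smul_apply, Finset.mul_sum, Complex.real_smul,
      Complex.ofReal_mul, hre, mul_assoc, ← e1]
    rw [Finset.sum_congr rfl fun d _ => Finset.sum_comm, Finset.sum_comm]
    refine Finset.sum_congr rfl fun l _ => Finset.sum_congr rfl fun d _ =>
      Finset.sum_congr rfl fun d' _ => ?_
    ring

lemma certifiesEntanglement_of_notMem_QLHS {A B X Y C : Type*} [Fintype A] [Fintype B]
    [Fintype C] [DecidableEq C] {σ : Family A B X Y C} (h : σ ∉ QLHS A B X Y C) :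
    CertifiesEntanglement σ := by
  rintro dA dB ρ M N hρ hM hN rfl hsep
  exact h (measured_mem_QLHS_of_isSeparableABC hρ hM hN hsep)

/-! ### Real symmetric matrices on a qubit -/

/-- The real symmetric matrix with diagonal `p, q` and off-diagonal entry `r`. -/
def realSym (p r q : ℝ) : Matrix (Fin 2) (Fin 2) ℂ := !![(p : ℂ), r; r, q]

lemma isHermitian_realSym (p r q : ℝ) : (realSym p r q).IsHermitian := by
  ext i j
  fin_cases i <;> fin_cases j <;> simp [realSym]

lemma trace_realSym (p r q : ℝ) : (realSym p r q).trace = p + q := by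
  simp [realSym, Matrix.trace_fin_two]

lemma smul_realSym (t p r q : ℝ) : t • realSym p r q = realSym (t * p) (t * r) (t * q) := by
  ext i j
  fin_cases i <;> fin_cases j <;> simp [realSym]

lemma realSym_add (p r q p' r' q' : ℝ) :
    realSym p r q + realSym p' r' q' = realSym (p + p') (r + r') (q + q') := by
  ext i j
  fin_cases i <;> fin_cases j <;> simp [realSym]

lemma realSym_sum {ι : Type*} (s : Finset ι) (p r q : ι → ℝ) :
    ∑ l ∈ s, realSym (p l) (r l) (q l) = realSym (∑ l ∈ s, p l) (∑ l ∈ s, r l) (∑ l ∈ s, q l) := by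
  ext i j
  fin_cases i <;> fin_cases j <;> simp [realSym, Matrix.sum_apply]

lemma pauliX_eq : pauliX = realSym 0 1 0 := by
  ext i j
  fin_cases i <;> fin_cases j <;> simp [realSym, pauliX]

lemma pauliZ_eq : pauliZ = realSym 1 0 (-1) := by
  ext i j
  fin_cases i <;> fin_cases j <;> simp [realSym, pauliZ]

lemma one_eq_realSym : (1 : Matrix (Fin 2) (Fin 2) ℂ) = realSym 1 0 1 := by
  ext i j
  fin_cases i <;> fin_cases j <;> simp [realSym]

lemma posSemidef_realSym {p r q : ℝ} (hp : 0 ≤ p) (hq : 0 ≤ q) (h : r ^ 2 ≤ p * q) :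
    (realSym p r q).PosSemidef := by
  refine posSemidef_iff_dotProduct_mulVec.2 ⟨isHermitian_realSym p r q, fun x => ?_⟩
  have key : star x ⬝ᵥ (realSym p r q *ᵥ x) =
      ((p * ((x 0).re ^ 2 + (x 0).im ^ 2) + q * ((x 1).re ^ 2 + (x 1).im ^ 2) +
        2 * r * ((x 0).re * (x 1).re + (x 0).im * (x 1).im) : ℝ) : ℂ) := by
    apply Complex.ext <;> simp [realSym, dotProduct, Matrix.mulVec, Fin.sum_univ_two, pow_two] <;>
      ring
  rw [key]
  -- For real symmetric matrices the form splits into the same real quadratic form at the real and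
  -- the imaginary parts; completing the square shows that it is nonnegative.
  have hform : ∀ u v : ℝ, 0 ≤ p * u ^ 2 + q * v ^ 2 + 2 * r * (u * v) := fun u v => by
    rcases hp.eq_or_lt with rfl | hp'
    · have hr : r = 0 := by nlinarith
      subst hr
      nlinarith [mul_nonneg hq (sq_nonneg v)]
    · have : 0 ≤ p * (p * u ^ 2 + q * v ^ 2 + 2 * r * (u * v)) := by
        nlinarith [sq_nonneg (p * u + r * v), mul_nonneg (sub_nonneg.2 h) (sq_nonneg v)]
      exact nonneg_of_mul_nonneg_right this hp'
  have h1 := hform (x 0).re (x 1).re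
  have h2 := hform (x 0).im (x 1).im
  have : 0 ≤ p * ((x 0).re ^ 2 + (x 0).im ^ 2) + q * ((x 1).re ^ 2 + (x 1).im ^ 2) +
        2 * r * ((x 0).re * (x 1).re + (x 0).im * (x 1).im) := by nlinarith
  exact_mod_cast this

/-- The components of a qubit state along `X` and `Z`. -/
lemma IsDensity.exists_bloch {ρ : Matrix (Fin 2) (Fin 2) ℂ} (hρ : IsDensity ρ) :
    ∃ x z : ℝ, x ^ 2 + z ^ 2 ≤ 1 ∧
      ∀ p r q, (realSym p r q * ρ).trace.re = (p + q) / 2 + r * x + (p - q) / 2 * z := by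
  have h10 : ρ 1 0 = star (ρ 0 1) := (hρ.1.1.apply 1 0).symm
  have hdet := (Complex.le_def.1 hρ.1.det_nonneg).1
  have htr := congrArg Complex.re hρ.2
  have h00 : (ρ 0 0).im = 0 := by
    have := congrArg Complex.im (hρ.1.1.apply 0 0)
    simp at this
    linarith
  rw [Matrix.det_fin_two, h10] at hdet
  rw [Matrix.trace_fin_two] at htr
  simp [h00] at hdet htr
  -- With unit trace, nonnegativity of the determinant says that the Bloch vector has length at most
  -- 1; dropping its Y component leaves the disc.
  refine ⟨2 * (ρ 0 1).re, (ρ 0 0).re - (ρ 1 1).re, ?_, fun p r q => ?_⟩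
  · have : (ρ 1 1).re = 1 - (ρ 0 0).re := by linarith
    rw [this] at hdet ⊢
    nlinarith [sq_nonneg (ρ 0 1).im]
  · have : (ρ 1 1).re = 1 - (ρ 0 0).re := by linarith
    rw [Matrix.trace_fin_two, Matrix.mul_apply, Matrix.mul_apply]
    simp [realSym, Fin.sum_univ_two, h10, this]
    ring

lemma re_trace_realSym_mul (p r q p' r' q' : ℝ) :
    (realSym p r q * realSym p' r' q').trace.re = p * p' + 2 * (r * r') + q * q' := by
  rw [Matrix.trace_fin_two, Matrix.mul_apply, Matrix.mul_apply]
  simp [realSym, Fin.sum_univ_two]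
  ring

lemma dichotomic_realSym (p r q : ℝ) (a : Fin 2) :
    dichotomic (realSym p r q) a = realSym ((1 + (-1) ^ (a : ℕ) * p) / 2)
      ((-1) ^ (a : ℕ) * r / 2) ((1 + (-1) ^ (a : ℕ) * q) / 2) := by
  rw [dichotomic, one_eq_realSym, smul_realSym, realSym_add, smul_realSym]
  congr 1 <;> ring

/-- The spectral projections of `r X + p Z` form a measurement. -/
lemma isPOVM_dichotomic {X : Type*} {p r : X → ℝ} (h : ∀ x, p x ^ 2 + r x ^ 2 ≤ 1) :
    IsPOVM fun x a => dichotomic (realSym (p x) (r x) (-p x)) a := by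
  have hp : ∀ x, p x ^ 2 ≤ 1 := fun x => by nlinarith [h x, sq_nonneg (r x)]
  have h1 : ∀ x, p x ≤ 1 := fun x => by nlinarith [hp x]
  have h2 : ∀ x, -1 ≤ p x := fun x => by nlinarith [hp x]
  refine ⟨fun x a => ?_, fun x => ?_⟩
  · dsimp only
    rw [dichotomic_realSym]
    fin_cases a <;>
      refine posSemidef_realSym ?_ ?_ ?_ <;> simp <;> nlinarith [h x, h1 x, h2 x]
  · simp only [dichotomic_realSym]
    rw [Fin.sum_univ_two, realSym_add, one_eq_realSym]
    congr 1 <;> simp <;> ring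

/-! ### A quadratic Tsirelson bound for quantum behaviors -/

/-- The two effects commute because they sum to 1, so `1 - (Q - R)² = 4QR = 4(QRQ + RQR)`, and the
last form is manifestly positive. No projectivity is needed, so general POVMs are covered without
dilation. -/
lemma posSemidef_one_sub_sq {D : Type*} [Fintype D] [DecidableEq D] {Q R : Matrix D D ℂ}
    (hQ : Q.PosSemidef) (hR : R.PosSemidef) (h : Q + R = 1) :
    (1 - (Q - R) * (Q - R)).PosSemidef := by
  have e : 1 - (Q - R) * (Q - R) = (4 : ℝ) • (Q * R * Qᴴ + R * Q * Rᴴ) := by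
    have hR' : R = 1 - Q := by rw [← h, add_sub_cancel_left]
    rw [hQ.1.eq, hR.1.eq, hR', ← Nat.cast_ofNat (R := ℝ), Nat.cast_smul_eq_nsmul]
    noncomm_ring
  rw [e]
  exact posSemidef_smul ((hR.mul_mul_conjTranspose_same Q).add (hQ.mul_mul_conjTranspose_same R))
    (by norm_num)

/-- The correlator `⟨A_x B_y⟩` of a behavior with binary outputs. -/
def correlator {X Y : Type*} (P : Box (Fin 2) (Fin 2) X Y) (x : X) (y : Y) : ℝ :=
  P 0 0 x y - P 0 1 x y - P 1 0 x y + P 1 1 x y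

section SumOfSquares

variable {D : Type*} [Fintype D] {ρ : Matrix D D ℂ}

lemma re_trace_mul_nonneg {T : Matrix D D ℂ} (hT : T.PosSemidef) (hρ : ρ.PosSemidef) :
    0 ≤ (T * ρ).trace.re :=
  (Complex.le_def.1 (trace_mul_nonneg hT hρ)).1

/-- The sum-of-squares argument behind the bound: `a₀, a₁` commute with `b₀, b₁`, all are
Hermitian with squares at most `1`, and `c² + s² ≤ 1`. -/
lemma re_trace_sum_of_squares [DecidableEq D] (hρ : IsDensity ρ) {a₀ a₁ b₀ b₁ : Matrix D D ℂ}
    (ha₀ : a₀.IsHermitian) (ha₁ : a₁.IsHermitian) (hb₀ : b₀.IsHermitian) (hb₁ : b₁.IsHermitian)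
    (h00 : b₀ * a₀ = a₀ * b₀) (h01 : b₁ * a₀ = a₀ * b₁) (h10 : b₀ * a₁ = a₁ * b₀)
    (h11 : b₁ * a₁ = a₁ * b₁) (sa₀ : (1 - a₀ * a₀).PosSemidef) (sa₁ : (1 - a₁ * a₁).PosSemidef)
    (sb₀ : (1 - b₀ * b₀).PosSemidef) (sb₁ : (1 - b₁ * b₁).PosSemidef) {c s : ℝ}
    (hcs : c ^ 2 + s ^ 2 ≤ 1) :
    c * ((a₀ * b₀ * ρ).trace.re - (a₁ * b₁ * ρ).trace.re) +
      s * ((a₀ * b₁ * ρ).trace.re + (a₁ * b₀ * ρ).trace.re) ≤ 2 := by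
  have sq : ∀ H : Matrix D D ℂ, H.IsHermitian → 0 ≤ (H * H * ρ).trace.re := fun H hH => by
    have h := posSemidef_conjTranspose_mul_self H
    rw [hH.eq] at h
    exact re_trace_mul_nonneg h hρ.1
  have hone : ((1 : Matrix D D ℂ) * ρ).trace.re = 1 := by
    rw [Matrix.one_mul, hρ.2, Complex.one_re]
  have le_one : ∀ H : Matrix D D ℂ, (1 - H * H).PosSemidef → (H * H * ρ).trace.re ≤ 1 :=
    fun H hH => by
      have h := re_trace_mul_nonneg hH hρ.1
      rw [Matrix.sub_mul, Matrix.trace_sub, Complex.sub_re, hone] at h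
      linarith
  have smul_herm : ∀ (r : ℝ) (H : Matrix D D ℂ), H.IsHermitian → (r • H).IsHermitian :=
    fun r H hH => by
      rw [Matrix.IsHermitian, Matrix.conjTranspose_smul, hH.eq, star_trivial]
  -- The functional is the expectation of `a₀ (c b₀ + s b₁) + a₁ (s b₀ - c b₁)`. Adding the squares
  -- of the two differences cancels the terms in `b₀ b₁` and `b₁ b₀`, leaving `a₀² + a₁² + (c² +
  -- s²)(b₀² + b₁²)` minus twice the functional.
  have k₀ := sq _ (ha₀.sub ((smul_herm c _ hb₀).add (smul_herm s _ hb₁)))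
  have k₁ := sq _ (ha₁.sub ((smul_herm s _ hb₀).sub (smul_herm c _ hb₁)))
  simp only [Matrix.sub_mul, Matrix.mul_sub, Matrix.add_mul, Matrix.mul_add, Matrix.smul_mul,
    Matrix.mul_smul, Matrix.trace_sub, Matrix.trace_add, Matrix.trace_smul, Complex.sub_re,
    Complex.add_re, Complex.real_smul, Complex.re_ofReal_mul, h00, h01, h10, h11] at k₀ k₁
  have ea₀ := le_one _ sa₀
  have ea₁ := le_one _ sa₁
  have eb₀ := le_one _ sb₀
  have eb₁ := le_one _ sb₁
  have nb₀ := sq _ hb₀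
  have nb₁ := sq _ hb₁
  have hb : (c ^ 2 + s ^ 2) * ((b₀ * b₀ * ρ).trace.re + (b₁ * b₁ * ρ).trace.re) ≤ 2 := by
    nlinarith
  nlinarith

end SumOfSquares

/-- In the application `(c, s)` are the Bloch components of a hidden state, so one bound covers all
states of Charlie. For `c = s = 1/√2` it is Tsirelson's bound `2√2` for a CHSH expression. -/
lemma quantum_correlator_bound {P : Box (Fin 2) (Fin 2) (Fin 2) (Fin 2)}
    (hP : IsQuantumBehavior P) {c s : ℝ} (hcs : c ^ 2 + s ^ 2 ≤ 1) :
    c * (correlator P 0 0 - correlator P 1 1) + s * (correlator P 0 1 + correlator P 1 0) ≤ 2 := by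
  obtain ⟨dA, dB, ρ, M, N, hρ, hM, hN, e⟩ := hP
  have hcor : ∀ x y, correlator P x y =
      (((M x 0 - M x 1) ⊗ₖ (1 : Matrix (Fin dB) (Fin dB) ℂ)) *
        ((1 : Matrix (Fin dA) (Fin dA) ℂ) ⊗ₖ (N y 0 - N y 1)) * ρ).trace.re := by
    intro x y
    have h : ((M x 0 - M x 1) ⊗ₖ (N y 0 - N y 1)) =
        M x 0 ⊗ₖ N y 0 - M x 0 ⊗ₖ N y 1 - M x 1 ⊗ₖ N y 0 + M x 1 ⊗ₖ N y 1 := by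
      ext i j
      simp only [kroneckerMap_apply, Matrix.sub_apply, Matrix.add_apply]
      ring
    have hre : ∀ a b, P a b x y = ((M x a ⊗ₖ N y b) * ρ).trace.re := fun a b => by
      rw [← e, Complex.ofReal_re]
    rw [← mul_kronecker_mul, Matrix.one_mul, Matrix.mul_one, h]
    simp only [Matrix.sub_mul, Matrix.add_mul, Matrix.trace_sub, Matrix.trace_add, Complex.sub_re,
      Complex.add_re, correlator, hre]
  have herm : ∀ {d : ℕ} {L : Fin 2 → Fin 2 → Matrix (Fin d) (Fin d) ℂ}, IsPOVM L → ∀ x,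
      (L x 0 - L x 1).IsHermitian := fun hL x => (hL.1 x 0).1.sub (hL.1 x 1).1
  have hsq : ∀ {d : ℕ} {L : Fin 2 → Fin 2 → Matrix (Fin d) (Fin d) ℂ}, IsPOVM L → ∀ x,
      (1 - (L x 0 - L x 1) * (L x 0 - L x 1)).PosSemidef := fun hL x =>
    posSemidef_one_sub_sq (hL.1 x 0) (hL.1 x 1) (by rw [← Fin.sum_univ_two, hL.2 x])
  have hermA : ∀ x, ((M x 0 - M x 1) ⊗ₖ (1 : Matrix (Fin dB) (Fin dB) ℂ)).IsHermitian := fun x => by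
    rw [Matrix.IsHermitian, conjTranspose_kronecker, (herm hM x).eq, conjTranspose_one]
  have hermB : ∀ y, ((1 : Matrix (Fin dA) (Fin dA) ℂ) ⊗ₖ (N y 0 - N y 1)).IsHermitian := fun y => by
    rw [Matrix.IsHermitian, conjTranspose_kronecker, (herm hN y).eq, conjTranspose_one]
  have hcomm : ∀ x y, ((1 : Matrix (Fin dA) (Fin dA) ℂ) ⊗ₖ (N y 0 - N y 1)) *
      ((M x 0 - M x 1) ⊗ₖ (1 : Matrix (Fin dB) (Fin dB) ℂ)) =
      ((M x 0 - M x 1) ⊗ₖ (1 : Matrix (Fin dB) (Fin dB) ℂ)) *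
        ((1 : Matrix (Fin dA) (Fin dA) ℂ) ⊗ₖ (N y 0 - N y 1)) := fun x y => by
    rw [← mul_kronecker_mul, ← mul_kronecker_mul]
    simp only [Matrix.one_mul, Matrix.mul_one]
  have sqA : ∀ x, (1 - ((M x 0 - M x 1) ⊗ₖ (1 : Matrix (Fin dB) (Fin dB) ℂ)) *
      ((M x 0 - M x 1) ⊗ₖ (1 : Matrix (Fin dB) (Fin dB) ℂ))).PosSemidef := fun x => by
    have h := (hsq hM x).kronecker (PosSemidef.one (n := Fin dB) (R := ℂ))
    rw [← mul_kronecker_mul, Matrix.mul_one, ← one_kronecker_one]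
    have e' : ∀ K : Matrix (Fin dA) (Fin dA) ℂ, 1 ⊗ₖ (1 : Matrix (Fin dB) (Fin dB) ℂ) - K ⊗ₖ 1 =
        (1 - K) ⊗ₖ (1 : Matrix (Fin dB) (Fin dB) ℂ) := fun K => by
      ext i j
      simp only [kroneckerMap_apply, Matrix.sub_apply, sub_mul]
    rw [e']
    exact h
  have sqB : ∀ y, (1 - ((1 : Matrix (Fin dA) (Fin dA) ℂ) ⊗ₖ (N y 0 - N y 1)) *
      ((1 : Matrix (Fin dA) (Fin dA) ℂ) ⊗ₖ (N y 0 - N y 1))).PosSemidef := fun y => by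
    have h := (PosSemidef.one (n := Fin dA) (R := ℂ)).kronecker (hsq hN y)
    rw [← mul_kronecker_mul, Matrix.mul_one, ← one_kronecker_one]
    have e' : ∀ K : Matrix (Fin dB) (Fin dB) ℂ, (1 : Matrix (Fin dA) (Fin dA) ℂ) ⊗ₖ 1 - 1 ⊗ₖ K =
        (1 : Matrix (Fin dA) (Fin dA) ℂ) ⊗ₖ (1 - K) := fun K => by
      ext i j
      simp only [kroneckerMap_apply, Matrix.sub_apply, mul_sub]
    rw [e']
    exact h
  simp only [hcor]
  exact re_trace_sum_of_squares hρ (hermA 0) (hermA 1) (hermB 0) (hermB 1) (hcomm 0 0) (hcomm 0 1)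
    (hcomm 1 0) (hcomm 1 1) (sqA 0) (sqA 1) (sqB 0) (sqB 1) hcs

/-! ### A realizable assemblage that is NS-LHS but not Q-LHS -/

/-- The signs of the three-qubit state stabilized by `X ⊗ X ⊗ X`, `-Z ⊗ Z ⊗ X`, `X ⊗ Z ⊗ Z` and
`Z ⊗ X ⊗ Z`. -/
def merminVec : Qubits → ℂ := fun q => if q = ((1, 1), 0) ∨ q = ((0, 0), 1) then -1 else 1

/-- The stabilizer state with signs `merminVec`, mixed with noise to visibility `7 / 10`. -/
def merminState : Matrix Qubits Qubits ℂ :=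
  (7 / 80 : ℝ) • vecMulVec merminVec (star merminVec) + (3 / 80 : ℝ) • (1 : Matrix Qubits Qubits ℂ)

/-- The measurements of `X` for input `0` and of `Z` for input `1`. -/
def merminMeas (x a : Fin 2) : Matrix (Fin 2) (Fin 2) ℂ :=
  dichotomic (realSym (![0, 1] x) (![1, 0] x) (-![0, 1] x)) a

/-- The assemblage obtained from `merminState`. -/
def merminAssemblage : Family (Fin 2) (Fin 2) (Fin 2) (Fin 2) (Fin 2) :=
  measured merminMeas merminMeas merminState

/-- Bloch components of Charlie's observables correlated with Alice's and Bob's outputs. -/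
def merminBloch (x y : Fin 2) (r t : ℝ) : ℝ := !![r, t; t, -r] x y

lemma isPOVM_merminMeas : IsPOVM merminMeas :=
  isPOVM_dichotomic fun x => by fin_cases x <;> simp

lemma trace_dichotomic (p r : ℝ) (a : Fin 2) :
    (dichotomic (realSym p r (-p)) a).trace = 1 := by
  rw [dichotomic_realSym, trace_realSym]
  push_cast
  ring

lemma isDensity_merminState : IsDensity merminState := by
  constructor
  · exact (posSemidef_smul (posSemidef_vecMulVec_self_star _) (by norm_num)).add
      (posSemidef_smul PosSemidef.one (by norm_num))
  · simp [merminState, Matrix.trace, merminVec, Fintype.sum_prod_type, Fin.sum_univ_two,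
      vecMulVec_apply]
    norm_num

lemma measured_merminVec {M N : Fin 2 → Fin 2 → Matrix (Fin 2) (Fin 2) ℂ} {a b x y : Fin 2}
    {m₀ m₁ m₂ n₀ n₁ n₂ : ℝ} (hM : M x a = realSym m₀ m₁ m₂) (hN : N y b = realSym n₀ n₁ n₂) :
    measured M N (vecMulVec merminVec (star merminVec)) a b x y =
      realSym ((m₀ + m₂) * (n₀ + n₂) + 2 * (n₁ * (m₀ - m₂) + m₁ * (n₀ - n₂)))
        (4 * (m₁ * n₁) - (m₀ - m₂) * (n₀ - n₂))
        ((m₀ + m₂) * (n₀ + n₂) - 2 * (n₁ * (m₀ - m₂) + m₁ * (n₀ - n₂))) := by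
  ext c c'
  rw [measured_apply, hM, hN]
  simp only [Fin.sum_univ_two, vecMulVec_apply, merminVec, Pi.star_apply]
  fin_cases c <;> fin_cases c' <;> simp [realSym] <;> ring

lemma merminAssemblage_eq (a b x y : Fin 2) :
    merminAssemblage a b x y =
      realSym (1 / 8 + (-1) ^ (a + b : ℕ) * (7 / 80) * merminBloch x y 0 1)
        ((-1) ^ (a + b : ℕ) * (7 / 80) * merminBloch x y 1 0)
        (1 / 8 - (-1) ^ (a + b : ℕ) * (7 / 80) * merminBloch x y 0 1) := by
  rw [merminAssemblage, merminState, measured_add, measured_smul, measured_smul, measured_one,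
    measured_merminVec (dichotomic_realSym _ _ _ _) (dichotomic_realSym _ _ _ _)]
  simp only [merminMeas, trace_dichotomic, mul_one, one_smul, one_eq_realSym, smul_realSym,
    realSym_add]
  fin_cases x <;> fin_cases y <;> congr 1 <;> simp [merminBloch, pow_add] <;> ring

lemma merminAssemblage_mem_quantumRealizable :
    merminAssemblage ∈ QuantumRealizable (Fin 2) (Fin 2) (Fin 2) (Fin 2) (Fin 2) :=
  ⟨2, 2, merminState, merminMeas, merminMeas, isDensity_merminState, isPOVM_merminMeas,
    isPOVM_merminMeas, rfl⟩

/-- The behavior with uniform marginals and correlators `E`. -/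
def correlatorBox (E : Fin 2 → Fin 2 → ℝ) : Box (Fin 2) (Fin 2) (Fin 2) (Fin 2) :=
  fun a b x y => (1 + (-1) ^ (a + b : ℕ) * E x y) / 4

lemma correlatorBox_noSignaling {E : Fin 2 → Fin 2 → ℝ} (h : ∀ x y, |E x y| ≤ 1) :
    IsBehavior (correlatorBox E) ∧
      (NoSignalingBtoA (correlatorBox E) ∧ NoSignalingAtoB (correlatorBox E)) := by
  refine ⟨⟨fun a b x y => ?_, fun x y => ?_⟩, fun a x y y' => ?_, fun b y x x' => ?_⟩
  · have := abs_le.1 (h x y)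
    rcases neg_one_pow_eq_or ℝ (a + b : ℕ) with h' | h' <;> simp only [correlatorBox, h'] <;>
      linarith
  · simp only [Fin.sum_univ_two, correlatorBox]
    norm_num
    ring
  · simp only [Fin.sum_univ_two, correlatorBox, pow_add]
    norm_num
    ring
  · simp only [Fin.sum_univ_two, correlatorBox, pow_add]
    norm_num
    ring

/-- The four hidden states have Bloch components `(±7/10, ±7/10)`, of length `7√2/10 < 1`, and each
comes with the PR box whose correlators carry the same two signs. Averaging over one sign at a time
kills the unwanted products. -/
lemma merminAssemblage_mem_NSLHS :
    merminAssemblage ∈ NSLHS (Fin 2) (Fin 2) (Fin 2) (Fin 2) (Fin 2) := by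
  refine ⟨isAssemblage_of_mem_quantumRealizable merminAssemblage_mem_quantumRealizable, ?_⟩
  refine HasLHSModel.of_unnormalized (ι := Fin 2 × Fin 2)
    (fun l => correlatorBox fun x y =>
      merminBloch x y ((-1) ^ (l.1 : ℕ)) ((-1) ^ (l.2 : ℕ)))
    (fun l => realSym (1 / 8 + 7 / 80 * (-1) ^ (l.2 : ℕ)) (7 / 80 * (-1) ^ (l.1 : ℕ))
      (1 / 8 - 7 / 80 * (-1) ^ (l.2 : ℕ)))
    (fun l => correlatorBox_noSignaling fun x y => ?_) (fun l => ?_) ?_ fun a b x y => ?_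
  · fin_cases x <;> fin_cases y <;> simp [merminBloch]
  · rcases neg_one_pow_eq_or ℝ (l.1 : ℕ) with h | h <;>
      rcases neg_one_pow_eq_or ℝ (l.2 : ℕ) with h' | h' <;> rw [h, h'] <;>
      exact posSemidef_realSym (by norm_num) (by norm_num) (by norm_num)
  · simp only [trace_realSym, Fintype.sum_prod_type, Fin.sum_univ_two]
    push_cast
    norm_num
  · rw [merminAssemblage_eq]
    simp only [smul_realSym, realSym_sum]
    simp only [Fintype.sum_prod_type, Fin.sum_univ_two, correlatorBox]
    fin_cases x <;> fin_cases y <;> congr 1 <;> simp [merminBloch] <;> ring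

/-- The witness `∑ ± A_x B_y C_{xy}` that bounds quantum hidden-state models by `2`. -/
def merminWitness : Family (Fin 2) (Fin 2) (Fin 2) (Fin 2) (Fin 2) := fun a b x y =>
  realSym ((-1) ^ (a + b : ℕ) * merminBloch x y 0 1) ((-1) ^ (a + b : ℕ) * merminBloch x y 1 0)
    (-((-1) ^ (a + b : ℕ) * merminBloch x y 0 1))

lemma merminAssemblage_notMem_QLHS :
    merminAssemblage ∉ QLHS (Fin 2) (Fin 2) (Fin 2) (Fin 2) (Fin 2) := by
  rintro ⟨-, h⟩
  obtain ⟨n, p, P, ρ, hp, hs, hP, hρ, e⟩ := h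
  have hle : witnessValue merminWitness merminAssemblage ≤ 2 := by
    rw [witnessValue_eq_sum merminWitness e]
    calc _ ≤ ∑ l, p l * 2 := Finset.sum_le_sum fun l _ =>
          mul_le_mul_of_nonneg_left ?_ (hp l)
      _ = 2 := by rw [← Finset.sum_mul, hs, one_mul]
    obtain ⟨x, z, hxz, htr⟩ := (hρ l).exists_bloch
    have hb := quantum_correlator_bound (hP l).2 hxz
    simp only [merminWitness, htr, Fin.sum_univ_two]
    simp only [correlator] at hb
    simp [merminBloch]
    linarith
  -- Each of the four stabilizer correlations contributes the visibility `7/10`.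
  have hval : witnessValue merminWitness merminAssemblage = 14 / 5 := by
    simp only [witnessValue, merminAssemblage_eq, merminWitness, Fin.sum_univ_two,
      Matrix.trace_fin_two]
    simp [realSym, merminBloch]
    norm_num
  rw [hval] at hle
  norm_num at hle

/-! ### Wirings -/

/-- The wiring `y = a` maps models without signaling from Bob to Alice to bipartite models. -/
lemma not_isSteerable_wired {A B X C : Type*} [Fintype A] [Nonempty A] [Fintype B] [Fintype C]
    {σ : Family A B X A C} (h : HasLHSModel NoSignalingBtoA σ) : ¬ IsSteerable (wired σ) := by
  obtain ⟨n, p, P, ρ, hp, hs, hP, hρ, e⟩ := h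
  refine not_not.2 ⟨n, p, fun l b x => ∑ a, P l a b x a, ρ, hp, hs,
    fun l b x => Finset.sum_nonneg fun a _ => (hP l).1.1 a b x a, fun l x => ?_, hρ, fun b x => ?_⟩
  -- Normalization is where signaling matters: Alice's marginal at `y = a` may be replaced by her
  -- marginal at one fixed input `a₀`, and then the sum over `a` is 1.
  · obtain ⟨a₀⟩ := ‹Nonempty A›
    rw [Finset.sum_comm, ← (hP l).1.2 x a₀]
    exact Finset.sum_congr rfl fun a _ => (hP l).2 a x a a₀
  · simp only [wired, e, Finset.mul_sum, Finset.sum_smul]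
    exact Finset.sum_comm

/-! ### The GHZ assemblage -/

lemma one_div_sqrt_two_sq : (1 / √2 : ℝ) ^ 2 = 1 / 2 := by
  rw [div_pow, Real.sq_sqrt (by norm_num)]
  norm_num

lemma measured_ghzVec {M N : Fin 2 → Fin 2 → Matrix (Fin 2) (Fin 2) ℂ} {a b x y : Fin 2}
    {m₀ m₁ m₂ n₀ n₁ n₂ : ℝ} (hM : M x a = realSym m₀ m₁ m₂) (hN : N y b = realSym n₀ n₁ n₂) :
    measured M N ghzState a b x y =
      realSym (m₀ * n₀ / 2) (m₁ * n₁ / 2) (m₂ * n₂ / 2) := by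
  have hw : ((1 / √2 : ℝ) : ℂ) * ((1 / √2 : ℝ) : ℂ) = 1 / 2 := by
    rw [← Complex.ofReal_mul, ← pow_two, one_div_sqrt_two_sq]
    norm_num
  ext c c'
  rw [measured_apply, hM, hN]
  simp only [Fin.sum_univ_two, ghzState, vecMulVec_apply, ghzVec, Pi.star_apply, apply_ite star,
    star_zero, RCLike.star_def, Complex.conj_ofReal]
  generalize ((1 / √2 : ℝ) : ℂ) = w at hw
  fin_cases c <;> fin_cases c' <;> simp [realSym] <;> rw [hw] <;> ring

lemma ghzMeasA_eq (x a : Fin 2) :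
    ghzMeasA x a = realSym (1 / 2) ((x : ℕ) * (-1) ^ (a : ℕ) / 2) (1 / 2) := by
  fin_cases x
  · simp [ghzMeasA, one_eq_realSym, smul_realSym]
  · simp [ghzMeasA, pauliX_eq, dichotomic_realSym]

lemma ghzMeasB_eq (y b : Fin 2) :
    ghzMeasB y b =
      dichotomic (realSym (1 / √2) ((-1) ^ (y : ℕ) * (1 / √2)) (-(1 / √2))) b := by
  rw [ghzMeasB, pauliX_eq, pauliZ_eq, smul_realSym, realSym_add, smul_realSym]
  congr 2 <;> ring

lemma isPOVM_ghzMeasA : IsPOVM ghzMeasA := by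
  refine ⟨fun x a => ?_, fun x => ?_⟩
  · rw [ghzMeasA_eq]
    refine posSemidef_realSym (by norm_num) (by norm_num) ?_
    rcases neg_one_pow_eq_or ℝ (a : ℕ) with h | h <;> rw [h] <;> fin_cases x <;> norm_num
  · simp only [ghzMeasA_eq, Fin.sum_univ_two, realSym_add, one_eq_realSym]
    congr 1 <;> simp <;> ring

lemma isPOVM_ghzMeasB : IsPOVM ghzMeasB := by
  have h : ghzMeasB = fun (y : Fin 2) b =>
      dichotomic (realSym (1 / √2) ((-1) ^ (y : ℕ) * (1 / √2)) (-(1 / √2))) b :=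
    funext fun y => funext fun b => ghzMeasB_eq y b
  rw [h]
  refine isPOVM_dichotomic fun y => ?_
  have hw := one_div_sqrt_two_sq
  rcases neg_one_pow_eq_or ℝ (y : ℕ) with h' | h' <;> rw [h'] <;> linarith

lemma isDensity_ghzState : IsDensity ghzState := by
  refine ⟨posSemidef_vecMulVec_self_star _, ?_⟩
  have hw : ((1 / √2 : ℝ) : ℂ) * ((1 / √2 : ℝ) : ℂ) = 1 / 2 := by
    rw [← Complex.ofReal_mul, ← pow_two, one_div_sqrt_two_sq]
    norm_num
  simp only [Matrix.trace, Matrix.diag_apply, ghzState, vecMulVec_apply, ghzVec, Pi.star_apply,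
    apply_ite star, star_zero, RCLike.star_def, Complex.conj_ofReal, Fintype.sum_prod_type,
    Fin.sum_univ_two]
  generalize ((1 / √2 : ℝ) : ℂ) = w at hw
  simp [hw]
  norm_num

lemma ghzAssemblage_mem_quantumRealizable :
    ghzAssemblage ∈ QuantumRealizable (Fin 2) (Fin 2) (Fin 2) (Fin 2) (Fin 2) :=
  ⟨2, 2, ghzState, ghzMeasA, ghzMeasB, isDensity_ghzState, isPOVM_ghzMeasA, isPOVM_ghzMeasB, rfl⟩

lemma ghzAssemblage_eq_realSym (a b x y : Fin 2) :
    ghzAssemblage a b x y = realSym (1 / 8 * (1 + (-1) ^ (b : ℕ) * (1 / √2)))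
      (1 / 8 * ((-1) ^ (b : ℕ) * (1 / √2) * ((x : ℕ) * (-1) ^ (a + y : ℕ))))
      (1 / 8 * (1 - (-1) ^ (b : ℕ) * (1 / √2))) := by
  rw [ghzAssemblage, measured_ghzVec (ghzMeasA_eq x a) ((ghzMeasB_eq y b).trans
    (dichotomic_realSym _ _ _ _))]
  congr 1 <;> ring

lemma ghzAssemblage_eq (a b x y : Fin 2) : ghzAssemblage a b x y =
    (1 / 8 : ℝ) • (1 + ((-1 : ℝ) ^ (b : ℕ) / √2) •
      (pauliZ + (((x : ℕ) : ℝ) * (-1 : ℝ) ^ ((a : ℕ) + (y : ℕ))) • pauliX)) := by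
  rw [ghzAssemblage_eq_realSym, one_eq_realSym, pauliX_eq, pauliZ_eq]
  simp only [smul_realSym, realSym_add]
  congr 1 <;> ring

lemma wired_ghzAssemblage_eq_realSym (b x : Fin 2) :
    wired ghzAssemblage b x = realSym (1 / 4 * (1 + (-1) ^ (b : ℕ) * (1 / √2)))
      (1 / 4 * ((-1) ^ (b : ℕ) * (1 / √2) * (x : ℕ)))
      (1 / 4 * (1 - (-1) ^ (b : ℕ) * (1 / √2))) := by
  simp only [wired, Fin.sum_univ_two, ghzAssemblage_eq_realSym, realSym_add]
  congr 1 <;> simp <;> ring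

lemma wired_ghzAssemblage_eq (b x : Fin 2) : wired ghzAssemblage b x =
    (1 / 4 : ℝ) • (1 + ((-1 : ℝ) ^ (b : ℕ) / √2) • (pauliZ + ((x : ℕ) : ℝ) • pauliX)) := by
  rw [wired_ghzAssemblage_eq_realSym, one_eq_realSym, pauliX_eq, pauliZ_eq]
  simp only [smul_realSym, realSym_add]
  congr 1 <;> ring

/-- Bob's output is the sign along `Z` of the hidden state; if `x = 1`, Alice's output depends on
`y` and on the sign along `X`. -/
lemma ghzAssemblage_mem_LHS :
    ghzAssemblage ∈ LHS (Fin 2) (Fin 2) (Fin 2) (Fin 2) (Fin 2) := by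
  refine ⟨isAssemblage_of_mem_quantumRealizable ghzAssemblage_mem_quantumRealizable, ?_⟩
  refine HasLHSModel.of_unnormalized (ι := Fin 2 × Fin 2)
    (fun l a b x y => (1 + (-1) ^ (b + l.1 : ℕ)) / 2 *
      ((1 + (x : ℕ) * (-1) ^ (a + b + y + l.2 : ℕ)) / 2))
    (fun l => realSym (1 / 8 * (1 + (-1) ^ (l.1 : ℕ) * (1 / √2)))
      (1 / 8 * ((-1) ^ (l.2 : ℕ) * (1 / √2))) (1 / 8 * (1 - (-1) ^ (l.1 : ℕ) * (1 / √2))))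
    (fun l => ⟨⟨fun a b x y => ?_, fun x y => ?_⟩, trivial⟩) (fun l => ?_) ?_ fun a b x y => ?_
  · rcases neg_one_pow_eq_or ℝ (b + l.1 : ℕ) with h | h <;>
      rcases neg_one_pow_eq_or ℝ (a + b + y + l.2 : ℕ) with h' | h' <;> dsimp only <;>
      rw [h, h'] <;>
      fin_cases x <;> norm_num
  · simp only [Fin.sum_univ_two, pow_add]
    norm_num
    ring
  · have hw := one_div_sqrt_two_sq
    have hw0 : 0 ≤ 1 / √2 := by positivity
    have hw1 : 1 / √2 ≤ 1 := by nlinarith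
    rcases neg_one_pow_eq_or ℝ (l.1 : ℕ) with h | h <;>
      rcases neg_one_pow_eq_or ℝ (l.2 : ℕ) with h' | h' <;> rw [h, h'] <;>
      refine posSemidef_realSym ?_ ?_ ?_ <;> nlinarith
  · simp only [trace_realSym, Fintype.sum_prod_type, Fin.sum_univ_two]
    push_cast
    norm_num
    ring
  · rw [ghzAssemblage_eq_realSym]
    simp only [smul_realSym, realSym_sum]
    simp only [Fintype.sum_prod_type, Fin.sum_univ_two, pow_add]
    fin_cases b <;> congr 1 <;> simp <;> ring

/-- Conditioned on `x = 1` Charlie's states are pure, which forces all hidden states to commute. -/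
lemma isSteerable_wired_ghzAssemblage : IsSteerable (wired ghzAssemblage) := by
  rintro ⟨n, p, Q, ρ, hp, hs, hQ, hQ1, hρ, e⟩
  have hw := one_div_sqrt_two_sq
  have hw0 : 0 < 1 / √2 := by positivity
  set w : ℝ := 1 / √2 with hwdef
  choose u v huv htr using fun l => (hρ l).exists_bloch
  have hexp : ∀ (b x : Fin 2) (d f g : ℝ), (realSym d f g * wired ghzAssemblage b x).trace.re =
      ∑ l, p l * Q l b x * ((d + g) / 2 + f * u l + (d - g) / 2 * v l) := fun b x d f g => by
    simp only [e, Matrix.mul_sum, Matrix.trace_sum, Complex.re_sum, Matrix.mul_smul,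
      Matrix.trace_smul, Complex.real_smul, Complex.re_ofReal_mul, htr]
  have hle : ∀ l, (w * (u l + v l)) ^ 2 ≤ 1 := fun l => by
    rw [mul_pow, hw]
    nlinarith [huv l, sq_nonneg (u l - v l)]
  -- For `x = 1` the state conditioned on `b` is pure. Testing with `1 - (-1)^b (X + Z)/√2`, twice
  -- the projection orthogonal to it, gives 0, so every nonnegative term of the model vanishes.
  have hzero : ∀ (b : Fin 2) l,
      p l * Q l b 1 * (1 - (-1) ^ (b : ℕ) * w * (u l + v l)) = 0 := by
    intro b l
    have hsum : ∑ l, p l * Q l b 1 * (1 - (-1) ^ (b : ℕ) * w * (u l + v l)) = 0 := by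
      have h := hexp b 1 (1 - (-1) ^ (b : ℕ) * w) (-((-1) ^ (b : ℕ) * w)) (1 + (-1) ^ (b : ℕ) * w)
      rw [wired_ghzAssemblage_eq_realSym, re_trace_realSym_mul, ← hwdef] at h
      have hb : ((-1 : ℝ) ^ (b : ℕ)) ^ 2 = 1 := by rw [← pow_mul, mul_comm, pow_mul]; norm_num
      calc _ = ∑ l, p l * Q l b 1 * ((1 - (-1) ^ (b : ℕ) * w + (1 + (-1) ^ (b : ℕ) * w)) / 2 +
            -((-1) ^ (b : ℕ) * w) * u l +
            (1 - (-1) ^ (b : ℕ) * w - (1 + (-1) ^ (b : ℕ) * w)) / 2 * v l) :=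
            Finset.sum_congr rfl fun l _ => by ring
        _ = 0 := by
            rw [← h]
            simp
            linear_combination (-w ^ 2) * hb - hw
    refine (Finset.sum_eq_zero_iff_of_nonneg fun l _ => ?_).1 hsum l (Finset.mem_univ l)
    refine mul_nonneg (mul_nonneg (hp l) (hQ l b 1)) ?_
    rcases neg_one_pow_eq_or ℝ (b : ℕ) with h | h <;> rw [h] <;> nlinarith [hle l]
  have hcomm : ∀ l, p l * (v l - u l) = 0 := fun l => by
    rcases eq_or_ne (p l) 0 with h | h
    · rw [h, zero_mul]
    -- A hidden state of nonzero weight gives some output `b` with nonzero probability for `x = 1`,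
    -- so it attains the extreme value of `(X + Z)/√2`; on the Bloch disc this forces `u = v`.
    · have heq : (w * (u l + v l)) ^ 2 = 1 := by
        have hQl := hQ1 l 1
        rw [Fin.sum_univ_two] at hQl
        have h0 := hzero 0 l
        have h1 := hzero 1 l
        simp [h] at h0 h1
        rcases h0 with h0 | h0
        · rcases h1 with h1 | h1
          · rw [h0, h1] at hQl
            norm_num at hQl
          · nlinarith
        · nlinarith
      rw [mul_pow, hw] at heq
      have : (v l - u l) ^ 2 ≤ 0 := by nlinarith [huv l]
      have : v l - u l = 0 := by nlinarith
      rw [this, mul_zero]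
  -- The test operator is `Z - X`: it vanishes on all hidden states that contribute, but has the
  -- value `w/2` on the conditional state for `x = 0`, `b = 0`.
  have h := hexp 0 0 1 (-1) (-1)
  rw [wired_ghzAssemblage_eq_realSym, re_trace_realSym_mul, ← hwdef] at h
  have h0 : ∑ l, p l * Q l 0 0 * ((1 + -1) / 2 + -1 * u l + (1 - -1) / 2 * v l) = 0 :=
    Finset.sum_eq_zero fun l _ => by linear_combination Q l 0 0 * hcomm l
  rw [h0] at h
  simp at h
  linarith

lemma ghzAssemblage_notMem_TOLHS :
    ghzAssemblage ∉ TOLHS (Fin 2) (Fin 2) (Fin 2) (Fin 2) (Fin 2) := fun h =>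
  not_isSteerable_wired h.2.1 isSteerable_wired_ghzAssemblage

/-! ### Linear functionals on non-signaling behaviors with binary inputs and outputs -/

lemma abs_add_abs_le {a b c : ℝ} (h₁ : a + b ≤ c) (h₂ : a - b ≤ c) (h₃ : -a + b ≤ c)
    (h₄ : -a - b ≤ c) : |a| + |b| ≤ c := by
  rcases abs_cases a with ⟨h, -⟩ | ⟨h, -⟩ <;> rcases abs_cases b with ⟨h', -⟩ | ⟨h', -⟩ <;>
    rw [h, h'] <;> linarith

/-- Three binary variables with prescribed means and pair correlators have a joint distribution if
all pair distributions are nonnegative and the four triangle inequalities hold; `s` is the triple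
correlator. -/
lemma exists_triple_correlator {A₀ A₁ B t E₀ E₁ : ℝ}
    (h₀₁ : ∀ a b : ℝ, a ^ 2 = 1 → b ^ 2 = 1 → 0 ≤ 1 + a * A₀ + b * A₁ + a * b * t)
    (h₀ : ∀ a b : ℝ, a ^ 2 = 1 → b ^ 2 = 1 → 0 ≤ 1 + a * A₀ + b * B + a * b * E₀)
    (h₁ : ∀ a b : ℝ, a ^ 2 = 1 → b ^ 2 = 1 → 0 ≤ 1 + a * A₁ + b * B + a * b * E₁)
    (hp : |E₀ + E₁| ≤ 1 + t) (hm : |E₀ - E₁| ≤ 1 - t) :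
    ∃ s : ℝ, ∀ a₀ a₁ b : ℝ, a₀ ^ 2 = 1 → a₁ ^ 2 = 1 → b ^ 2 = 1 →
      0 ≤ 1 + a₀ * A₀ + a₁ * A₁ + b * B + a₀ * a₁ * t + a₀ * b * E₀ + a₁ * b * E₁ +
        a₀ * a₁ * b * s := by
  have one : (1 : ℝ) ^ 2 = 1 := by norm_num
  have neg : (-1 : ℝ) ^ 2 = 1 := by norm_num
  have p1 := h₀₁ 1 1 one one
  have p2 := h₀₁ 1 (-1) one neg
  have p3 := h₀₁ (-1) 1 neg one
  have p4 := h₀₁ (-1) (-1) neg neg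
  have q1 := h₀ 1 1 one one
  have q2 := h₀ 1 (-1) one neg
  have q3 := h₀ (-1) 1 neg one
  have q4 := h₀ (-1) (-1) neg neg
  have r1 := h₁ 1 1 one one
  have r2 := h₁ 1 (-1) one neg
  have r3 := h₁ (-1) 1 neg one
  have r4 := h₁ (-1) (-1) neg neg
  obtain ⟨hp1, hp2⟩ := abs_le.1 hp
  obtain ⟨hm1, hm2⟩ := abs_le.1 hm
  -- Sign triples with product 1 bound `s` from below and those with product -1 from above. A lower
  -- and an upper bound whose triples differ in one sign are compatible by positivity of a pair
  -- distribution, and those that differ in all three signs by a triangle inequality. So the largest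
  -- lower bound works.
  let l₁ := -(1 + A₀ + A₁ + B + t + E₀ + E₁)
  let l₂ := -(1 + A₀ - A₁ - B - t - E₀ + E₁)
  let l₃ := -(1 - A₀ + A₁ - B - t + E₀ - E₁)
  let l₄ := -(1 - A₀ - A₁ + B + t - E₀ - E₁)
  have k₁ : l₁ ≤ max (max l₁ l₂) (max l₃ l₄) := (le_max_left _ _).trans (le_max_left _ _)
  have k₂ : l₂ ≤ max (max l₁ l₂) (max l₃ l₄) := (le_max_right _ _).trans (le_max_left _ _)
  have k₃ : l₃ ≤ max (max l₁ l₂) (max l₃ l₄) := (le_max_left _ _).trans (le_max_right _ _)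
  have k₄ : l₄ ≤ max (max l₁ l₂) (max l₃ l₄) := (le_max_right _ _).trans (le_max_right _ _)
  have hu : ∀ u, l₁ ≤ u → l₂ ≤ u → l₃ ≤ u → l₄ ≤ u → max (max l₁ l₂) (max l₃ l₄) ≤ u :=
    fun u g₁ g₂ g₃ g₄ => max_le (max_le g₁ g₂) (max_le g₃ g₄)
  have u₁ := hu (1 - A₀ - A₁ - B + t + E₀ + E₁) (by linarith) (by linarith) (by linarith)
    (by linarith)
  have u₂ := hu (1 - A₀ + A₁ + B - t - E₀ + E₁) (by linarith) (by linarith) (by linarith)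
    (by linarith)
  have u₃ := hu (1 + A₀ - A₁ + B - t + E₀ - E₁) (by linarith) (by linarith) (by linarith)
    (by linarith)
  have u₄ := hu (1 + A₀ + A₁ - B + t - E₀ - E₁) (by linarith) (by linarith) (by linarith)
    (by linarith)
  refine ⟨max (max l₁ l₂) (max l₃ l₄), fun a₀ a₁ b ha₀ ha₁ hb => ?_⟩
  rcases sq_eq_one_iff.1 ha₀ with rfl | rfl <;> rcases sq_eq_one_iff.1 ha₁ with rfl | rfl <;>
    rcases sq_eq_one_iff.1 hb with rfl | rfl <;> linarith

/-- The value of a linear functional with coefficients `k, α, β, γ` on the behavior with marginals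
`A, B` and correlators `E`. -/
def functionalValue (k : ℝ) (α β : Fin 2 → ℝ) (γ : Fin 2 → Fin 2 → ℝ) (A B : Fin 2 → ℝ)
    (E : Fin 2 → Fin 2 → ℝ) : ℝ :=
  k + (α 0 * A 0 + α 1 * A 1) + (β 0 * B 0 + β 1 * B 1) +
    (γ 0 0 * E 0 0 + γ 0 1 * E 0 1 + γ 1 0 * E 1 0 + γ 1 1 * E 1 1)

/-- The value on the deterministic behavior with outputs `a₀, a₁` and `b₀, b₁`. -/
def localValue (k : ℝ) (α β : Fin 2 → ℝ) (γ : Fin 2 → Fin 2 → ℝ) (a₀ a₁ b₀ b₁ : ℝ) : ℝ :=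
  functionalValue k α β γ ![a₀, a₁] ![b₀, b₁] ![![a₀ * b₀, a₀ * b₁], ![a₁ * b₀, a₁ * b₁]]

section Functional

variable {k : ℝ} {α β : Fin 2 → ℝ} {γ : Fin 2 → Fin 2 → ℝ} {A B : Fin 2 → ℝ}
  {E : Fin 2 → Fin 2 → ℝ}

/-- Behaviors that violate a CHSH inequality are mixtures of a PR box and of the eight
deterministic behaviors that saturate this inequality. -/
lemma functionalValue_nonpos_of_chsh
    (hpos : ∀ x y, ∀ a b : ℝ, a ^ 2 = 1 → b ^ 2 = 1 → 0 ≤ 1 + a * A x + b * B y + a * b * E x y)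
    (hloc : ∀ a₀ a₁ b₀ b₁ : ℝ, a₀ ^ 2 = 1 → a₁ ^ 2 = 1 → b₀ ^ 2 = 1 → b₁ ^ 2 = 1 →
      localValue k α β γ a₀ a₁ b₀ b₁ ≤ 0)
    {e f g h : ℝ} (he : e ^ 2 = 1) (hf : f ^ 2 = 1) (hg : g ^ 2 = 1) (hefgh : h = -(e * f * g))
    (hpr : functionalValue k α β γ 0 0 ![![e, f], ![g, h]] ≤ 0)
    (hchsh : 2 ≤ e * E 0 0 + f * E 0 1 + g * E 1 0 + h * E 1 1) :
    functionalValue k α β γ A B E ≤ 0 := by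
  subst hefgh
  have one : (1 : ℝ) ^ 2 = 1 := by norm_num
  have neg : (-1 : ℝ) ^ 2 = 1 := by norm_num
  have sq : ∀ {u v : ℝ}, u ^ 2 = 1 → v ^ 2 = 1 → (u * v) ^ 2 = 1 := fun hu hv => by
    rw [mul_pow, hu, hv, one_mul]
  have sqn : ∀ {u : ℝ}, u ^ 2 = 1 → (-u) ^ 2 = 1 := fun hu => by rw [neg_sq, hu]
  -- Each of the eight strategies satisfies three of the four CHSH correlations and violates the
  -- fourth with prescribed outputs. A PR box never violates one, so the weight of a strategy must
  -- be the probability of the losing output pair belonging to it; the coefficients here are four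
  -- times these probabilities.
  have key : ∀ a : ℝ, a ^ 2 = 1 →
      (1 + a * A 0 - e * a * B 0 - e * E 0 0) *
        localValue k α β γ a (-(g * e * a)) (-(e * a)) (f * a) +
      (1 + a * A 0 - f * a * B 1 - f * E 0 1) *
        localValue k α β γ a (e * g * a) (e * a) (-(f * a)) +
      (1 + a * A 1 - g * a * B 0 - g * E 1 0) *
        localValue k α β γ (-(e * g * a)) a (-(g * a)) (-(e * f * g * a)) +
      (1 + a * A 1 + e * f * g * a * B 1 + e * f * g * E 1 1) *
        localValue k α β γ (e * g * a) a (g * a) (e * f * g * a) ≤ 0 := by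
    intro a ha
    have m : ∀ {u w : ℝ}, 0 ≤ u → w ≤ 0 → u * w ≤ 0 := mul_nonpos_of_nonneg_of_nonpos
    have n₁ := m (hpos 0 0 a (-(e * a)) ha (sqn (sq he ha))) (hloc a (-(g * e * a)) (-(e * a))
      (f * a) ha (sqn (sq (sq hg he) ha)) (sqn (sq he ha)) (sq hf ha))
    have n₂ := m (hpos 0 1 a (-(f * a)) ha (sqn (sq hf ha))) (hloc a (e * g * a) (e * a)
      (-(f * a)) ha (sq (sq he hg) ha) (sq he ha) (sqn (sq hf ha)))
    have n₃ := m (hpos 1 0 a (-(g * a)) ha (sqn (sq hg ha))) (hloc (-(e * g * a)) a (-(g * a))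
      (-(e * f * g * a)) (sqn (sq (sq he hg) ha)) ha (sqn (sq hg ha))
      (sqn (sq (sq (sq he hf) hg) ha)))
    have n₄ := m (hpos 1 1 a (e * f * g * a) ha (sq (sq (sq he hf) hg) ha)) (hloc (e * g * a) a
      (g * a) (e * f * g * a) (sq (sq he hg) ha) ha (sq hg ha) (sq (sq (sq he hf) hg) ha))
    have r : ∀ u v : ℝ, a * (-(u * a)) * v = -(u * v) := fun u v => by
      linear_combination (-(u * v)) * ha
    have r' : ∀ u v : ℝ, a * (u * a) * v = u * v := fun u v => by
      linear_combination (u * v) * ha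
    rw [r, show ∀ u v w z : ℝ, 1 + u + -v * w + -z = 1 + u - v * w - z from fun _ _ _ _ => by ring]
      at n₁ n₂ n₃
    rw [r'] at n₄
    linarith
  have kp := key 1 one
  have kn := key (-1) neg
  -- The remaining weight, half the excess of the CHSH value over 2, goes to the PR box.
  have kpr := mul_nonpos_of_nonneg_of_nonpos (sub_nonneg.2 hchsh) hpr
  clear hpos hloc key hpr hchsh
  rcases sq_eq_one_iff.1 he with rfl | rfl <;> rcases sq_eq_one_iff.1 hf with rfl | rfl <;>
    rcases sq_eq_one_iff.1 hg with rfl | rfl <;>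
    simp only [localValue, functionalValue, Matrix.cons_val_zero, Matrix.cons_val_one,
      Pi.zero_apply] at kp kn kpr ⊢ <;> linarith

/-- Behaviors that satisfy all CHSH inequalities are mixtures of deterministic ones. -/
lemma functionalValue_nonpos_of_local
    (hpos : ∀ x y, ∀ a b : ℝ, a ^ 2 = 1 → b ^ 2 = 1 → 0 ≤ 1 + a * A x + b * B y + a * b * E x y)
    (hloc : ∀ a₀ a₁ b₀ b₁ : ℝ, a₀ ^ 2 = 1 → a₁ ^ 2 = 1 → b₀ ^ 2 = 1 → b₁ ^ 2 = 1 →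
      localValue k α β γ a₀ a₁ b₀ b₁ ≤ 0)
    (hchsh : ∀ e f g : ℝ, e ^ 2 = 1 → f ^ 2 = 1 → g ^ 2 = 1 →
      e * E 0 0 + f * E 0 1 + g * E 1 0 + -(e * f * g) * E 1 1 ≤ 2) :
    functionalValue k α β γ A B E ≤ 0 := by
  have one : (1 : ℝ) ^ 2 = 1 := by norm_num
  have neg : (-1 : ℝ) ^ 2 = 1 := by norm_num
  -- This is Fine's argument: a joint distribution of all four outputs is built from a value `t` of
  -- the unobserved correlator of Alice's two outputs. The constraints are lower bounds on `1 + t`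
  -- and upper bounds given by `1 - t`; they are compatible if each pair sums to at most 2.
  -- Positivity gives all these inequalities except those mixing `y = 0` with `y = 1` correlators,
  -- which are CHSH.
  have mixed : ∀ y, |A 0 + A 1| + |E 0 y - E 1 y| ≤ 2 ∧ |E 0 y + E 1 y| + |A 0 - A 1| ≤ 2 ∧
      |E 0 y + E 1 y| + |E 0 y - E 1 y| ≤ 2 := fun y => by
    have p1 := hpos 0 y 1 1 one one
    have p2 := hpos 0 y 1 (-1) one neg
    have p3 := hpos 0 y (-1) 1 neg one
    have p4 := hpos 0 y (-1) (-1) neg neg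
    have q1 := hpos 1 y 1 1 one one
    have q2 := hpos 1 y 1 (-1) one neg
    have q3 := hpos 1 y (-1) 1 neg one
    have q4 := hpos 1 y (-1) (-1) neg neg
    refine ⟨?_, ?_, ?_⟩ <;> apply abs_add_abs_le <;> linarith
  have marg : |A 0 + A 1| + |A 0 - A 1| ≤ 2 := by
    have p1 := hpos 0 0 1 1 one one
    have p2 := hpos 0 0 1 (-1) one neg
    have p3 := hpos 0 0 (-1) 1 neg one
    have p4 := hpos 0 0 (-1) (-1) neg neg
    have q1 := hpos 1 0 1 1 one one
    have q2 := hpos 1 0 1 (-1) one neg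
    have q3 := hpos 1 0 (-1) 1 neg one
    have q4 := hpos 1 0 (-1) (-1) neg neg
    apply abs_add_abs_le <;> linarith
  have chsh : |E 0 0 + E 1 0| + |E 0 1 - E 1 1| ≤ 2 ∧ |E 0 1 + E 1 1| + |E 0 0 - E 1 0| ≤ 2 := by
    have c1 := hchsh 1 1 1 one one one
    have c2 := hchsh 1 1 (-1) one one neg
    have c3 := hchsh 1 (-1) 1 one neg one
    have c4 := hchsh 1 (-1) (-1) one neg neg
    have c5 := hchsh (-1) 1 1 neg one one
    have c6 := hchsh (-1) 1 (-1) neg one neg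
    have c7 := hchsh (-1) (-1) 1 neg neg one
    have c8 := hchsh (-1) (-1) (-1) neg neg neg
    constructor <;> apply abs_add_abs_le <;> linarith
  obtain ⟨m00, m01, m02⟩ := mixed 0
  obtain ⟨m10, m11, m12⟩ := mixed 1
  let t := max |A 0 + A 1| (max |E 0 0 + E 1 0| |E 0 1 + E 1 1|) - 1
  have tA : |A 0 + A 1| ≤ 1 + t := by
    linarith [le_max_left |A 0 + A 1| (max |E 0 0 + E 1 0| |E 0 1 + E 1 1|)]
  have t0 : |E 0 0 + E 1 0| ≤ 1 + t := by
    linarith [(le_max_left |E 0 0 + E 1 0| |E 0 1 + E 1 1|).trans (le_max_right |A 0 + A 1| _)]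
  have t1 : |E 0 1 + E 1 1| ≤ 1 + t := by
    linarith [(le_max_right |E 0 0 + E 1 0| |E 0 1 + E 1 1|).trans (le_max_right |A 0 + A 1| _)]
  have tu : ∀ u, |A 0 + A 1| + u ≤ 2 → |E 0 0 + E 1 0| + u ≤ 2 → |E 0 1 + E 1 1| + u ≤ 2 →
      u ≤ 1 - t := fun u h h' h'' => by
    have := max_le (show |A 0 + A 1| ≤ 2 - u by linarith)
      (max_le (show |E 0 0 + E 1 0| ≤ 2 - u by linarith)
        (show |E 0 1 + E 1 1| ≤ 2 - u by linarith))
    linarith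
  have sA := tu _ marg m01 m11
  have s0 := tu _ m00 m02 chsh.2
  have s1 := tu _ m10 chsh.1 m12
  clear_value t
  have hpair : ∀ a b : ℝ, a ^ 2 = 1 → b ^ 2 = 1 → 0 ≤ 1 + a * A 0 + b * A 1 + a * b * t := by
    intro a b ha hb
    obtain ⟨x1, x2⟩ := abs_le.1 tA
    obtain ⟨x3, x4⟩ := abs_le.1 sA
    rcases sq_eq_one_iff.1 ha with rfl | rfl <;> rcases sq_eq_one_iff.1 hb with rfl | rfl <;>
      linarith
  obtain ⟨u, hu⟩ := exists_triple_correlator hpair (hpos 0 0) (hpos 1 0) t0 s0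
  obtain ⟨v, hv⟩ := exists_triple_correlator hpair (hpos 0 1) (hpos 1 1) t1 s1
  -- For fixed outputs of Alice, the distributions of `b₀` and of `b₁` are glued together; `r` is
  -- the unnormalized weight of `b₀ = b₁ = 1`. The smaller of the two marginal weights is an
  -- admissible choice. The functional has no term in `b₀ b₁` or `a₀ a₁`, so `r`, `t`, `u` and `v`
  -- cancel in the final sum.
  have key : ∀ a₀ a₁ : ℝ, a₀ ^ 2 = 1 → a₁ ^ 2 = 1 → ∃ r : ℝ,
      r * localValue k α β γ a₀ a₁ 1 1 +
      (1 + a₀ * A 0 + a₁ * A 1 + B 0 + a₀ * a₁ * t + a₀ * E 0 0 + a₁ * E 1 0 + a₀ * a₁ * u - r) *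
        localValue k α β γ a₀ a₁ 1 (-1) +
      (1 + a₀ * A 0 + a₁ * A 1 + B 1 + a₀ * a₁ * t + a₀ * E 0 1 + a₁ * E 1 1 + a₀ * a₁ * v - r) *
        localValue k α β γ a₀ a₁ (-1) 1 +
      (r - (B 0 + B 1 + a₀ * E 0 0 + a₁ * E 1 0 + a₀ * E 0 1 + a₁ * E 1 1 + a₀ * a₁ * (u + v))) *
        localValue k α β γ a₀ a₁ (-1) (-1) ≤ 0 := by
    intro a₀ a₁ h₀ h₁
    have hu1 := hu a₀ a₁ 1 h₀ h₁ one
    have hu2 := hu a₀ a₁ (-1) h₀ h₁ neg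
    have hv1 := hv a₀ a₁ 1 h₀ h₁ one
    have hv2 := hv a₀ a₁ (-1) h₀ h₁ neg
    have m : ∀ {u w : ℝ}, 0 ≤ u → w ≤ 0 → u * w ≤ 0 := mul_nonpos_of_nonneg_of_nonpos
    refine ⟨min (1 + a₀ * A 0 + a₁ * A 1 + B 0 + a₀ * a₁ * t + a₀ * E 0 0 + a₁ * E 1 0 +
      a₀ * a₁ * u) (1 + a₀ * A 0 + a₁ * A 1 + B 1 + a₀ * a₁ * t + a₀ * E 0 1 + a₁ * E 1 1 +
      a₀ * a₁ * v), ?_⟩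
    refine add_nonpos (add_nonpos (add_nonpos (m ?_ (hloc _ _ _ _ h₀ h₁ one one))
      (m ?_ (hloc _ _ _ _ h₀ h₁ one neg))) (m ?_ (hloc _ _ _ _ h₀ h₁ neg one)))
      (m ?_ (hloc _ _ _ _ h₀ h₁ neg neg))
    · exact le_min (by linarith) (by linarith)
    · exact sub_nonneg.2 (min_le_left _ _)
    · exact sub_nonneg.2 (min_le_right _ _)
    · exact sub_nonneg.2 (le_min (by linarith) (by linarith))
  obtain ⟨r₁, k₁⟩ := key 1 1 one one
  obtain ⟨r₂, k₂⟩ := key 1 (-1) one neg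
  obtain ⟨r₃, k₃⟩ := key (-1) 1 neg one
  obtain ⟨r₄, k₄⟩ := key (-1) (-1) neg neg
  simp only [localValue, functionalValue, Matrix.cons_val_zero, Matrix.cons_val_one]
    at k₁ k₂ k₃ k₄ ⊢
  linarith

/-- A linear functional that is nonpositive on the deterministic behaviors and on the PR boxes is
nonpositive on all non-signaling behaviors. -/
lemma functionalValue_nonpos
    (hpos : ∀ x y, ∀ a b : ℝ, a ^ 2 = 1 → b ^ 2 = 1 → 0 ≤ 1 + a * A x + b * B y + a * b * E x y)
    (hloc : ∀ a₀ a₁ b₀ b₁ : ℝ, a₀ ^ 2 = 1 → a₁ ^ 2 = 1 → b₀ ^ 2 = 1 → b₁ ^ 2 = 1 →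
      localValue k α β γ a₀ a₁ b₀ b₁ ≤ 0)
    (hpr : ∀ e f g : ℝ, e ^ 2 = 1 → f ^ 2 = 1 → g ^ 2 = 1 →
      functionalValue k α β γ 0 0 ![![e, f], ![g, -(e * f * g)]] ≤ 0) :
    functionalValue k α β γ A B E ≤ 0 := by
  by_cases h : ∀ e f g : ℝ, e ^ 2 = 1 → f ^ 2 = 1 → g ^ 2 = 1 →
      e * E 0 0 + f * E 0 1 + g * E 1 0 + -(e * f * g) * E 1 1 ≤ 2
  · exact functionalValue_nonpos_of_local hpos hloc h
  · push Not at h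
    obtain ⟨e, f, g, he, hf, hg, hlt⟩ := h
    exact functionalValue_nonpos_of_chsh hpos hloc he hf hg rfl (hpr e f g he hf hg) hlt.le

end Functional

/-- Alice's mean output. -/
def meanA (P : Box (Fin 2) (Fin 2) (Fin 2) (Fin 2)) (x : Fin 2) : ℝ :=
  P 0 0 x 0 + P 0 1 x 0 - P 1 0 x 0 - P 1 1 x 0

/-- Bob's mean output. -/
def meanB (P : Box (Fin 2) (Fin 2) (Fin 2) (Fin 2)) (y : Fin 2) : ℝ :=
  P 0 0 0 y + P 1 0 0 y - P 0 1 0 y - P 1 1 0 y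

/-- The means are defined with the other party's input set to 0; no-signaling makes them valid for
every input, so means and correlators determine the behavior. -/
lemma box_eq_correlators {P : Box (Fin 2) (Fin 2) (Fin 2) (Fin 2)} (hP : IsBehavior P)
    (hBA : NoSignalingBtoA P) (hAB : NoSignalingAtoB P) (x y : Fin 2) :
    P 0 0 x y = (1 + meanA P x + meanB P y + correlator P x y) / 4 ∧
    P 0 1 x y = (1 + meanA P x - meanB P y - correlator P x y) / 4 ∧
    P 1 0 x y = (1 - meanA P x + meanB P y - correlator P x y) / 4 ∧
    P 1 1 x y = (1 - meanA P x - meanB P y + correlator P x y) / 4 := by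
  have h := hP.2 x y
  have a0 := hBA 0 x 0 y
  have a1 := hBA 1 x 0 y
  have b0 := hAB 0 y 0 x
  have b1 := hAB 1 y 0 x
  simp only [Fin.sum_univ_two] at h a0 a1 b0 b1
  simp only [meanA, meanB, correlator]
  refine ⟨?_, ?_, ?_, ?_⟩ <;> linarith

lemma correlators_nonneg {P : Box (Fin 2) (Fin 2) (Fin 2) (Fin 2)} (hP : IsBehavior P)
    (hBA : NoSignalingBtoA P) (hAB : NoSignalingAtoB P) (x y : Fin 2) (a b : ℝ) (ha : a ^ 2 = 1)
    (hb : b ^ 2 = 1) :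
    0 ≤ 1 + a * meanA P x + b * meanB P y + a * b * correlator P x y := by
  obtain ⟨h00, h01, h10, h11⟩ := box_eq_correlators hP hBA hAB x y
  have p00 := hP.1 0 0 x y
  have p01 := hP.1 0 1 x y
  have p10 := hP.1 1 0 x y
  have p11 := hP.1 1 1 x y
  rcases sq_eq_one_iff.1 ha with rfl | rfl <;> rcases sq_eq_one_iff.1 hb with rfl | rfl <;>
    linarith

/-! ### The noisy W assemblage -/

/-- The components along `Z` of the observables measured on the noisy W state. -/
def wZ (η : ℝ) (x : Fin 2) : ℝ := ![√(1 - η ^ 2), -η] x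

/-- The components along `X` of the observables measured on the noisy W state. -/
def wX (η : ℝ) (x : Fin 2) : ℝ := ![η, √(1 - η ^ 2)] x

lemma wMeas_eq (η : ℝ) (x a : Fin 2) :
    wMeas η x a = dichotomic (realSym (wZ η x) (wX η x) (-wZ η x)) a := by
  rw [wMeas]
  congr 1
  fin_cases x <;> ext i j <;> fin_cases i <;> fin_cases j <;>
    simp [pauliX, pauliZ, realSym, wZ, wX]

lemma isPOVM_wMeas {η : ℝ} (hη : η ^ 2 ≤ 1) : IsPOVM (wMeas η) := by
  have h : wMeas η = fun (x : Fin 2) a =>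
      dichotomic (realSym (wZ η x) (wX η x) (-wZ η x)) a :=
    funext fun x => funext fun a => wMeas_eq η x a
  rw [h]
  refine isPOVM_dichotomic fun x => ?_
  have hs : √(1 - η ^ 2) ^ 2 = 1 - η ^ 2 := Real.sq_sqrt (by linarith)
  fin_cases x <;> simp only [wZ, wX, Fin.zero_eta, Fin.mk_one, Matrix.cons_val_zero,
    Matrix.cons_val_one] <;> linarith

lemma one_div_sqrt_three_mul_self :
    ((1 / √3 : ℝ) : ℂ) * ((1 / √3 : ℝ) : ℂ) = 1 / 3 := by
  rw [← Complex.ofReal_mul, ← pow_two, div_pow, Real.sq_sqrt (by norm_num)]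
  norm_num

lemma isDensity_noisyWState {v : ℝ} (h0 : 0 ≤ v) (h1 : v ≤ 1) : IsDensity (noisyWState v) := by
  refine ⟨(posSemidef_smul (posSemidef_vecMulVec_self_star _) h0).add
      (posSemidef_smul PosSemidef.one (by linarith)), ?_⟩
  have hw := one_div_sqrt_three_mul_self
  simp only [noisyWState, Matrix.trace, Matrix.diag_apply, Matrix.add_apply, Matrix.smul_apply,
    vecMulVec_apply, wVec, Pi.star_apply, apply_ite star, star_zero, RCLike.star_def,
    Complex.conj_ofReal, Fintype.sum_prod_type, Fin.sum_univ_two]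
  generalize ((1 / √3 : ℝ) : ℂ) = w at hw
  simp [hw]
  ring

lemma measured_wVec {M N : Fin 2 → Fin 2 → Matrix (Fin 2) (Fin 2) ℂ} {a b x y : Fin 2}
    {m₀ m₁ m₂ n₀ n₁ n₂ : ℝ} (hM : M x a = realSym m₀ m₁ m₂) (hN : N y b = realSym n₀ n₁ n₂) :
    measured M N (vecMulVec wVec (star wVec)) a b x y =
      realSym ((m₀ * n₂ + m₂ * n₀ + 2 * (m₁ * n₁)) / 3) ((m₀ * n₁ + m₁ * n₀) / 3)
        (m₀ * n₀ / 3) := by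
  have hw := one_div_sqrt_three_mul_self
  ext c c'
  rw [measured_apply, hM, hN]
  simp only [Fin.sum_univ_two, vecMulVec_apply, wVec, Pi.star_apply, apply_ite star,
    star_zero, RCLike.star_def, Complex.conj_ofReal]
  generalize ((1 / √3 : ℝ) : ℂ) = w at hw
  fin_cases c <;> fin_cases c' <;> simp [realSym, hw] <;> ring

lemma noisyWAssemblage_eq (η v : ℝ) (a b x y : Fin 2) :
    noisyWAssemblage η v a b x y =
      realSym
        (v / 6 * (1 + (-1) ^ (a : ℕ) * (-1) ^ (b : ℕ) * (wX η x * wX η y - wZ η x * wZ η y)) +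
          (1 - v) / 8)
        (v / 12 * ((1 + (-1) ^ (a : ℕ) * wZ η x) * ((-1) ^ (b : ℕ) * wX η y) +
          (1 + (-1) ^ (b : ℕ) * wZ η y) * ((-1) ^ (a : ℕ) * wX η x)))
        (v / 12 * ((1 + (-1) ^ (a : ℕ) * wZ η x) * (1 + (-1) ^ (b : ℕ) * wZ η y)) +
          (1 - v) / 8) := by
  rw [noisyWAssemblage, noisyWState, measured_add, measured_smul, measured_smul, measured_one,
    measured_wVec ((wMeas_eq η x a).trans (dichotomic_realSym _ _ _ _))
      ((wMeas_eq η y b).trans (dichotomic_realSym _ _ _ _))]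
  simp only [wMeas_eq, trace_dichotomic, mul_one, one_smul, one_eq_realSym, smul_realSym,
    realSym_add]
  congr 1 <;> ring

lemma noisyWAssemblage_swap (η v : ℝ) (a b x y : Fin 2) :
    noisyWAssemblage η v a b x y = noisyWAssemblage η v b a y x := by
  rw [noisyWAssemblage_eq, noisyWAssemblage_eq]
  congr 1 <;> ring

lemma noisyWAssemblage_mem_quantumRealizable {η v : ℝ} (hη : η ^ 2 ≤ 1) (h0 : 0 ≤ v)
    (h1 : v ≤ 1) :
    noisyWAssemblage η v ∈ QuantumRealizable (Fin 2) (Fin 2) (Fin 2) (Fin 2) (Fin 2) :=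
  ⟨2, 2, noisyWState v, wMeas η, wMeas η, isDensity_noisyWState h0 h1, isPOVM_wMeas hη,
    isPOVM_wMeas hη, rfl⟩

/-! ### A witness for non-signaling hidden-state models -/

/-- The constant term of the witness, as coefficients of `1`, `X` and `Z`. -/
def wWitnessConst : Fin 3 → ℝ := ![-50, 0, 3]

/-- The marginal terms of the witness. -/
def wWitnessMarginal : Fin 2 → Fin 3 → ℝ := ![![-2, 17, -4], ![11, 5, 18]]

/-- The correlation terms of the witness. -/
def wWitnessCorrelation : Fin 2 → Fin 2 → Fin 3 → ℝ :=
  ![![![-6, 7, 11], ![0, -15, 8]], ![![0, -15, 8], ![-4, -8, -19]]]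

/-- The coefficients of `1`, `X` and `Z` in the witness. -/
def wWitnessCoeff (a b x y : Fin 2) (i : Fin 3) : ℝ :=
  (wWitnessConst i / 4 + ((-1) ^ (a : ℕ) * wWitnessMarginal x i +
    (-1) ^ (b : ℕ) * wWitnessMarginal y i) / 2 +
    (-1) ^ (a : ℕ) * (-1) ^ (b : ℕ) * wWitnessCorrelation x y i) / 200

/-- A witness that is nonpositive on `NSLHS` and positive on noisy W assemblages. -/
def wWitness : Family (Fin 2) (Fin 2) (Fin 2) (Fin 2) (Fin 2) := fun a b x y =>
  realSym (wWitnessCoeff a b x y 0 + wWitnessCoeff a b x y 2) (wWitnessCoeff a b x y 1)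
    (wWitnessCoeff a b x y 0 - wWitnessCoeff a b x y 2)

/-- By Cauchy–Schwarz, the linear part is at most `-c₀` on the unit disc. -/
lemma bloch_nonpos {c₀ c₁ c₂ u v : ℝ} (h : u ^ 2 + v ^ 2 ≤ 1) (h₀ : c₀ ≤ 0)
    (hc : c₁ ^ 2 + c₂ ^ 2 ≤ c₀ ^ 2) : c₀ + c₁ * u + c₂ * v ≤ 0 := by
  have h1 : (c₁ * u + c₂ * v) ^ 2 ≤ (-c₀) ^ 2 := by
    nlinarith [sq_nonneg (c₁ * v - c₂ * u), mul_le_mul hc h (by positivity) (sq_nonneg c₀)]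
  have := abs_le_of_sq_le_sq' h1 (by linarith)
  linarith [this.2]

/-- A functional whose coefficients are affine in the Bloch components `u, v` of a state is
nonpositive if this holds for the cone conditions at all extremal non-signaling behaviors. -/
lemma functionalValue_bloch_nonpos {k : Fin 3 → ℝ} {α : Fin 2 → Fin 3 → ℝ}
    {γ : Fin 2 → Fin 2 → Fin 3 → ℝ} {A B : Fin 2 → ℝ} {E : Fin 2 → Fin 2 → ℝ} {u v : ℝ}
    (huv : u ^ 2 + v ^ 2 ≤ 1)
    (hpos : ∀ x y, ∀ a b : ℝ, a ^ 2 = 1 → b ^ 2 = 1 → 0 ≤ 1 + a * A x + b * B y + a * b * E x y)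
    (hloc : ∀ a₀ a₁ b₀ b₁ : ℝ, a₀ ^ 2 = 1 → a₁ ^ 2 = 1 → b₀ ^ 2 = 1 → b₁ ^ 2 = 1 →
      localValue (k 0) (fun x => α x 0) (fun x => α x 0) (fun x y => γ x y 0) a₀ a₁ b₀ b₁ ≤ 0 ∧
      localValue (k 1) (fun x => α x 1) (fun x => α x 1) (fun x y => γ x y 1) a₀ a₁ b₀ b₁ ^ 2 +
      localValue (k 2) (fun x => α x 2) (fun x => α x 2) (fun x y => γ x y 2) a₀ a₁ b₀ b₁ ^ 2 ≤
      localValue (k 0) (fun x => α x 0) (fun x => α x 0) (fun x y => γ x y 0) a₀ a₁ b₀ b₁ ^ 2)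
    (hpr : ∀ e f g : ℝ, e ^ 2 = 1 → f ^ 2 = 1 → g ^ 2 = 1 → ∀ E' : Fin 2 → Fin 2 → ℝ,
      E' = ![![e, f], ![g, -(e * f * g)]] →
      functionalValue (k 0) (fun x => α x 0) (fun x => α x 0) (fun x y => γ x y 0) 0 0 E' ≤ 0 ∧
      functionalValue (k 1) (fun x => α x 1) (fun x => α x 1) (fun x y => γ x y 1) 0 0 E' ^ 2 +
      functionalValue (k 2) (fun x => α x 2) (fun x => α x 2) (fun x y => γ x y 2) 0 0 E' ^ 2 ≤
      functionalValue (k 0) (fun x => α x 0) (fun x => α x 0) (fun x y => γ x y 0) 0 0 E' ^ 2) :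
    functionalValue (k 0 + k 1 * u + k 2 * v) (fun x => α x 0 + α x 1 * u + α x 2 * v)
      (fun x => α x 0 + α x 1 * u + α x 2 * v)
      (fun x y => γ x y 0 + γ x y 1 * u + γ x y 2 * v) A B E ≤ 0 := by
  refine functionalValue_nonpos hpos (fun a₀ a₁ b₀ b₁ h₀ h₁ h₂ h₃ => ?_)
    fun e f g he hf hg => ?_
  · obtain ⟨l₁, l₂⟩ := hloc a₀ a₁ b₀ b₁ h₀ h₁ h₂ h₃
    refine le_trans (le_of_eq ?_) (bloch_nonpos huv l₁ l₂)
    simp only [localValue, functionalValue]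
    ring
  · obtain ⟨l₁, l₂⟩ := hpr e f g he hf hg _ rfl
    refine le_trans (le_of_eq ?_) (bloch_nonpos huv l₁ l₂)
    simp only [functionalValue]
    ring

lemma isHermitian_wWitness (a b x y : Fin 2) : (wWitness a b x y).IsHermitian :=
  isHermitian_realSym _ _ _

/-- Summing over inputs counts the constant term four times and each marginal term twice, which the
factors `1/4` and `1/2` in `wWitnessCoeff` undo. -/
lemma wWitness_eval {P : Box (Fin 2) (Fin 2) (Fin 2) (Fin 2)} (hP : IsBehavior P)
    (hBA : NoSignalingBtoA P) (hAB : NoSignalingAtoB P) {ρ : Matrix (Fin 2) (Fin 2) ℂ} {u v : ℝ}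
    (htr : ∀ p r q, (realSym p r q * ρ).trace.re = (p + q) / 2 + r * u + (p - q) / 2 * v) :
    ∑ a, ∑ b, ∑ x, ∑ y, P a b x y * (wWitness a b x y * ρ).trace.re =
      functionalValue (wWitnessConst 0 + wWitnessConst 1 * u + wWitnessConst 2 * v)
        (fun x => wWitnessMarginal x 0 + wWitnessMarginal x 1 * u + wWitnessMarginal x 2 * v)
        (fun x => wWitnessMarginal x 0 + wWitnessMarginal x 1 * u + wWitnessMarginal x 2 * v)
        (fun x y => wWitnessCorrelation x y 0 + wWitnessCorrelation x y 1 * u +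
          wWitnessCorrelation x y 2 * v) (meanA P) (meanB P) (correlator P) / 200 := by
  have h := box_eq_correlators hP hBA hAB
  simp only [wWitness, htr, Fin.sum_univ_two, (h _ _).1, (h _ _).2.1, (h _ _).2.2.1,
    (h _ _).2.2.2, wWitnessCoeff, functionalValue, Fin.val_zero, Fin.val_one, pow_zero, pow_one]
  ring

lemma witnessValue_wWitness_mem {σ : Family (Fin 2) (Fin 2) (Fin 2) (Fin 2) (Fin 2)}
    (hσ : σ ∈ NSLHS (Fin 2) (Fin 2) (Fin 2) (Fin 2) (Fin 2)) :
    witnessValue wWitness σ ∈ Set.Icc (-1) 0 := by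
  refine witnessValue_mem_Icc hσ.2 fun P hP hNS ρ hρ => ?_
  obtain ⟨u, v, huv, htr⟩ := hρ.exists_bloch
  have hpos := correlators_nonneg hP hNS.1 hNS.2
  rw [wWitness_eval hP hNS.1 hNS.2 htr]
  have upper := functionalValue_bloch_nonpos (k := wWitnessConst) (α := wWitnessMarginal)
    (γ := wWitnessCorrelation) huv hpos
    (fun a₀ a₁ b₀ b₁ h₀ h₁ h₂ h₃ => by
      rcases sq_eq_one_iff.1 h₀ with rfl | rfl <;> rcases sq_eq_one_iff.1 h₁ with rfl | rfl <;>
      rcases sq_eq_one_iff.1 h₂ with rfl | rfl <;> rcases sq_eq_one_iff.1 h₃ with rfl | rfl <;>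
      simp only [localValue, functionalValue, wWitnessConst, wWitnessMarginal, wWitnessCorrelation,
        Matrix.cons_val_zero, Matrix.cons_val_one, Matrix.cons_val] <;> norm_num)
    (fun e f g he hf hg E' hE' => by
      subst hE'
      rcases sq_eq_one_iff.1 he with rfl | rfl <;> rcases sq_eq_one_iff.1 hf with rfl | rfl <;>
      rcases sq_eq_one_iff.1 hg with rfl | rfl <;>
      simp only [functionalValue, wWitnessConst, wWitnessMarginal, wWitnessCorrelation,
        Matrix.cons_val_zero, Matrix.cons_val_one, Matrix.cons_val] <;> norm_num)
  -- The same test applied to `-200` minus the functional; after the division by 200 it is the lower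
  -- bound `-1`.
  have lower := functionalValue_bloch_nonpos
    (k := fun i => -![200, 0, 0] i - wWitnessConst i) (α := fun x i => -wWitnessMarginal x i)
    (γ := fun x y i => -wWitnessCorrelation x y i) huv hpos
    (fun a₀ a₁ b₀ b₁ h₀ h₁ h₂ h₃ => by
      rcases sq_eq_one_iff.1 h₀ with rfl | rfl <;> rcases sq_eq_one_iff.1 h₁ with rfl | rfl <;>
      rcases sq_eq_one_iff.1 h₂ with rfl | rfl <;> rcases sq_eq_one_iff.1 h₃ with rfl | rfl <;>
      simp only [localValue, functionalValue, wWitnessConst, wWitnessMarginal, wWitnessCorrelation,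
        Matrix.cons_val_zero, Matrix.cons_val_one, Matrix.cons_val] <;> norm_num)
    (fun e f g he hf hg E' hE' => by
      subst hE'
      rcases sq_eq_one_iff.1 he with rfl | rfl <;> rcases sq_eq_one_iff.1 hf with rfl | rfl <;>
      rcases sq_eq_one_iff.1 hg with rfl | rfl <;>
      simp only [functionalValue, wWitnessConst, wWitnessMarginal, wWitnessCorrelation,
        Matrix.cons_val_zero, Matrix.cons_val_one, Matrix.cons_val] <;> norm_num)
  simp only [functionalValue, Matrix.cons_val_zero, Matrix.cons_val_one, Matrix.cons_val]
    at upper lower ⊢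
  constructor <;> linarith

/-- The irrational `√(1 - η²)` is henceforth a variable `s` with rational square and tight rational
bounds, so that the numerical claims become linear arithmetic. -/
lemma sqrt_bounds : √(1 - 0.97177 ^ 2 : ℝ) ^ 2 = 1 - 0.97177 ^ 2 ∧
    0.23593 ≤ √(1 - 0.97177 ^ 2 : ℝ) ∧ √(1 - 0.97177 ^ 2 : ℝ) ≤ 0.235931 := by
  refine ⟨Real.sq_sqrt (by norm_num), Real.le_sqrt_of_sq_le (by norm_num),
    Real.sqrt_le_iff.2 ⟨by norm_num, by norm_num⟩⟩

lemma witnessValue_wWitness_pos {v : ℝ} (h : 0.64 ≤ v) :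
    0 < witnessValue wWitness (noisyWAssemblage 0.97177 v) := by
  obtain ⟨hs, hl, hu⟩ := sqrt_bounds
  simp only [witnessValue, wWitness, noisyWAssemblage_eq, re_trace_realSym_mul, Fin.sum_univ_two,
    wWitnessCoeff, wZ, wX, wWitnessConst, wWitnessMarginal, wWitnessCorrelation, Fin.val_zero,
    Fin.val_one, pow_zero, pow_one, Matrix.cons_val_zero, Matrix.cons_val_one, Matrix.cons_val]
  generalize √(1 - 0.97177 ^ 2 : ℝ) = s at hs hl hu
  -- The witness value involves `v * s` and `v * s ^ 2`; these products make it linear in quantities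
  -- with known bounds.
  have h1 : 0 ≤ (v - 0.64) * (s - 0.23593) := mul_nonneg (by linarith) (by linarith)
  have h2 : 0 ≤ (v - 0.64) * (0.235931 - s) := mul_nonneg (by linarith) (by linarith)
  have h3 : v * s ^ 2 = v * (1 - 0.97177 ^ 2) := by rw [hs]
  ring_nf at h1 h2 h3 ⊢
  linarith

/-! ### Time-ordered models of the noisy W assemblage -/

/-- The deterministic behavior in which Alice outputs `f x` and Bob outputs `g x y`. -/
def detBox (f : Fin 2 → Fin 2) (g : Fin 2 → Fin 2 → Fin 2) : Box (Fin 2) (Fin 2) (Fin 2) (Fin 2) :=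
  fun a b x y => if a = f x ∧ b = g x y then 1 else 0

lemma detBox_noSignalingBtoA (f : Fin 2 → Fin 2) (g : Fin 2 → Fin 2 → Fin 2) :
    IsBehavior (detBox f g) ∧ NoSignalingBtoA (detBox f g) := by
  have hsum : ∀ a x y, ∑ b, detBox f g a b x y = if a = f x then 1 else 0 := fun a x y => by
    simp [detBox, ite_and]
  refine ⟨⟨fun a b x y => ?_, fun x y => ?_⟩, fun a x y y' => ?_⟩
  · rw [detBox]
    split_ifs <;> norm_num
  · simp [hsum]
  · rw [hsum, hsum]

/-- Alice's outputs in the sixteen strategies of the model. -/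
def wOutputA : Fin 16 → Fin 2 → Fin 2 :=
  ![![0, 0], ![0, 0], ![0, 0], ![0, 0], ![0, 0], ![0, 1], ![0, 1], ![0, 1],
    ![1, 0], ![1, 0], ![1, 1], ![1, 1], ![1, 1], ![1, 1], ![1, 1], ![1, 1]]

/-- Bob's outputs in the sixteen strategies of the model. -/
def wOutputB : Fin 16 → Fin 2 → Fin 2 → Fin 2 :=
  ![![![0, 0], ![0, 1]], ![![0, 0], ![1, 1]], ![![0, 1], ![1, 0]], ![![1, 0], ![0, 0]],
    ![![1, 0], ![1, 1]], ![![0, 1], ![0, 0]], ![![0, 1], ![0, 1]], ![![1, 1], ![0, 1]],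
    ![![1, 0], ![0, 1]], ![![1, 1], ![0, 0]], ![![0, 0], ![0, 0]], ![![0, 0], ![0, 1]],
    ![![0, 1], ![1, 1]], ![![1, 0], ![1, 0]], ![![1, 1], ![1, 0]], ![![1, 1], ![1, 1]]]

/-- The unnormalized hidden states at visibility `0.64`, as upper left, off-diagonal and lower right
entries; `s` stands for `√(1 - 0.97177 ^ 2)`. -/
def wHidden (s : ℝ) : Fin 16 → Fin 3 → ℝ :=
  ![![7 / 625 + 97177 / 234375 * s, 654118557 / 15625000000, 83 / 5000 + 941 / 312500 * s],
    ![1279 / 15000 - 97177 / 468750 * s, -97868557 / 31250000000 + 4 / 75 * s,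
      5257 / 1250000 - 941 / 625000 * s],
    ![11 / 400, 191 / 10000, 149 / 5000],
    ![163 / 10000, -139 / 10000, 33 / 2500],
    ![389 / 10000, -51 / 2500, 1 / 80],
    ![701 / 10000, 91 / 2000, 149 / 5000],
    ![2455869329 / 46875000000 - 97177 / 468750 * s, 30344329 / 93750000000 + 47177 / 937500 * s,
      3918080671 / 187500000000 + 197177 / 1875000 * s],
    ![26168557 / 15625000000, 343 / 10000 - 97177 / 937500 * s, 13062119329 / 187500000000],
    ![5207431829 / 46875000000 - 97177 / 468750 * s, -572868557 / 31250000000 + 47177 / 937500 * s,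
      916443557 / 62500000000 - 941 / 625000 * s],
    ![204293557 / 15625000000, -13 / 2500 + 941 / 312500 * s, 127656443 / 62500000000],
    ![263 / 10000, 37 / 2500, 87 / 10000],
    ![3 / 2500, 43 / 10000, 211 / 10000],
    ![458981057 / 15625000000, -191 / 10000 - 97177 / 937500 * s, 12293369329 / 187500000000],
    ![204293557 / 15625000000, -13 / 2500 + 941 / 312500 * s, 127656443 / 62500000000],
    ![3210556829 / 23437500000, -551 / 10000 + 47177 / 468750 * s, 232068557 / 31250000000],
    ![-833 / 30000 + 97177 / 468750 * s, -1858469329 / 93750000000 - 4 / 75 * s,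
      281729 / 3750000 - 197177 / 1875000 * s]]

/-- The determinants are quadratic in `s`; once `s ^ 2` is replaced by its value they are affine,
and the bounds on `s` decide their signs. -/
lemma posSemidef_wHidden {s : ℝ} (hs : s ^ 2 = 1 - 0.97177 ^ 2) (hl : 0.23593 ≤ s)
    (hu : s ≤ 0.235931) (l : Fin 16) :
    (realSym (wHidden s l 0) (wHidden s l 1) (wHidden s l 2)).PosSemidef := by
  have h : 0 ≤ wHidden s l 0 ∧ 0 ≤ wHidden s l 2 ∧
      wHidden s l 1 ^ 2 ≤ wHidden s l 0 * wHidden s l 2 := by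
    fin_cases l <;> simp only [wHidden, Fin.reduceFinMk, Matrix.cons_val_zero, Matrix.cons_val_one,
      Matrix.cons_val] <;> refine ⟨?_, ?_, ?_⟩ <;> linarith
  exact posSemidef_realSym h.1 h.2.1 h.2.2

set_option maxHeartbeats 1000000 in
lemma noisyWAssemblage_eq_sum (a b x y : Fin 2) :
    noisyWAssemblage 0.97177 0.64 a b x y =
      ∑ l, detBox (wOutputA l) (wOutputB l) a b x y •
        realSym (wHidden √(1 - 0.97177 ^ 2) l 0) (wHidden √(1 - 0.97177 ^ 2) l 1)
          (wHidden √(1 - 0.97177 ^ 2) l 2) := by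
  obtain ⟨hs, -, -⟩ := sqrt_bounds
  rw [noisyWAssemblage_eq]
  simp only [smul_realSym, realSym_sum, wX, wZ]
  generalize √(1 - 0.97177 ^ 2 : ℝ) = s at hs
  fin_cases a <;> fin_cases b <;> fin_cases x <;> fin_cases y <;>
    simp [Fin.sum_univ_succ, detBox, wOutputA, wOutputB, wHidden] <;> congr 1 <;> linarith

/-- Lowering the visibility adds white noise, for which Charlie's state is maximally mixed and the
outputs are uniform. A model at 0.64 thus extends to all smaller visibilities by one more hidden
state, the `none` of `Option (Fin 16)` below. -/
lemma noisyWAssemblage_eq_mix (η v : ℝ) (a b x y : Fin 2) :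
    noisyWAssemblage η v a b x y = (v / 0.64) • noisyWAssemblage η 0.64 a b x y +
      (1 / 4 : ℝ) • realSym ((1 - v / 0.64) / 2) 0 ((1 - v / 0.64) / 2) := by
  simp only [noisyWAssemblage_eq, smul_realSym, realSym_add]
  congr 1 <;> ring

lemma hasLHSModel_noisyWAssemblage {v : ℝ} (h0 : 0 ≤ v) (h1 : v ≤ 0.64) :
    HasLHSModel NoSignalingBtoA (noisyWAssemblage 0.97177 v) := by
  obtain ⟨hs, hl, hu⟩ := sqrt_bounds
  have hv : 0 ≤ v / 0.64 := div_nonneg h0 (by norm_num)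
  have hv1 : v / 0.64 ≤ 1 := (div_le_one (by norm_num)).2 h1
  refine HasLHSModel.of_unnormalized (ι := Option (Fin 16))
    (fun o => o.elim (correlatorBox 0) fun l => detBox (wOutputA l) (wOutputB l))
    (fun o => o.elim (realSym ((1 - v / 0.64) / 2) 0 ((1 - v / 0.64) / 2)) fun l =>
      (v / 0.64) • realSym (wHidden √(1 - 0.97177 ^ 2) l 0) (wHidden √(1 - 0.97177 ^ 2) l 1)
        (wHidden √(1 - 0.97177 ^ 2) l 2)) (fun o => ?_) (fun o => ?_) ?_ fun a b x y => ?_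
  · rcases o with _ | l
    · have h := correlatorBox_noSignaling (E := 0) fun x y => by simp
      exact ⟨h.1, h.2.1⟩
    · exact detBox_noSignalingBtoA _ _
  · rcases o with _ | l
    · exact posSemidef_realSym (by linarith) (by linarith) (by nlinarith)
    · exact posSemidef_smul (posSemidef_wHidden hs hl hu l) hv
  · have htot : ∑ l, (wHidden √(1 - 0.97177 ^ 2) l 0 + wHidden √(1 - 0.97177 ^ 2) l 2) = 1 := by
      simp [Fin.sum_univ_succ, wHidden]
      ring
    rw [Fintype.sum_option]
    simp only [Option.elim, smul_realSym, trace_realSym, ← Complex.ofReal_add, ← mul_add,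
      ← Complex.ofReal_sum, ← Finset.mul_sum, htot]
    push_cast
    ring
  · rw [noisyWAssemblage_eq_mix, noisyWAssemblage_eq_sum, Fintype.sum_option, Finset.smul_sum,
      add_comm]
    simp only [Option.elim, smul_comm (v / 0.64)]
    congr 2
    simp [correlatorBox]

/-- The W state is symmetric and both parties measure the same observables, so exchanging them turns
the model for one order into a model for the other. -/
lemma noisyWAssemblage_mem_TOLHS {v : ℝ} (h0 : 0 ≤ v) (h1 : v ≤ 0.64) :
    noisyWAssemblage 0.97177 v ∈ TOLHS (Fin 2) (Fin 2) (Fin 2) (Fin 2) (Fin 2) := by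
  refine ⟨isAssemblage_of_mem_quantumRealizable (noisyWAssemblage_mem_quantumRealizable
    (by norm_num) h0 (by linarith)), hasLHSModel_noisyWAssemblage h0 h1, ?_⟩
  have h := (hasLHSModel_noisyWAssemblage h0 h1).swap
  have e : (fun b a y x => noisyWAssemblage 0.97177 v a b x y) = noisyWAssemblage 0.97177 v := by
    funext b a y x
    exact noisyWAssemblage_swap _ _ _ _ _ _
  rwa [e] at h

lemma noisyWAssemblage_notMem_NSLHS {v : ℝ} (h : 0.64 ≤ v) :
    noisyWAssemblage 0.97177 v ∉ NSLHS (Fin 2) (Fin 2) (Fin 2) (Fin 2) (Fin 2) := fun hm =>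
  (witnessValue_wWitness_pos h).not_ge (witnessValue_wWitness_mem hm).2

end

end Steering

/-! ### Assembly: inclusions and the three separating examples -/

open Steering in
theorem theoremS1 :
    -- the inclusions, for arbitrary finite output sets, input sets and dimension of Charlie
    (∀ (A B X Y C : Type*) [Fintype A] [Fintype B] [Fintype C],
      QLHS A B X Y C ⊆ NSLHS A B X Y C ∧
      NSLHS A B X Y C ⊆ TOLHS A B X Y C ∧
      TOLHS A B X Y C ⊆ LHS A B X Y C) ∧
    -- strictness, with binary inputs and outputs and a qubit of Charlie
    (QLHS (Fin 2) (Fin 2) (Fin 2) (Fin 2) (Fin 2) ⊂ NSLHS (Fin 2) (Fin 2) (Fin 2) (Fin 2) (Fin 2) ∧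
      NSLHS (Fin 2) (Fin 2) (Fin 2) (Fin 2) (Fin 2) ⊂
        TOLHS (Fin 2) (Fin 2) (Fin 2) (Fin 2) (Fin 2) ∧
      TOLHS (Fin 2) (Fin 2) (Fin 2) (Fin 2) (Fin 2) ⊂
        LHS (Fin 2) (Fin 2) (Fin 2) (Fin 2) (Fin 2)) ∧
    -- strictness among the quantum-realizable assemblages
    (QLHS (Fin 2) (Fin 2) (Fin 2) (Fin 2) (Fin 2) ∩
          QuantumRealizable (Fin 2) (Fin 2) (Fin 2) (Fin 2) (Fin 2) ⊂
        NSLHS (Fin 2) (Fin 2) (Fin 2) (Fin 2) (Fin 2) ∩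
          QuantumRealizable (Fin 2) (Fin 2) (Fin 2) (Fin 2) (Fin 2) ∧
      NSLHS (Fin 2) (Fin 2) (Fin 2) (Fin 2) (Fin 2) ∩
          QuantumRealizable (Fin 2) (Fin 2) (Fin 2) (Fin 2) (Fin 2) ⊂
        TOLHS (Fin 2) (Fin 2) (Fin 2) (Fin 2) (Fin 2) ∩
          QuantumRealizable (Fin 2) (Fin 2) (Fin 2) (Fin 2) (Fin 2) ∧
      TOLHS (Fin 2) (Fin 2) (Fin 2) (Fin 2) (Fin 2) ∩
          QuantumRealizable (Fin 2) (Fin 2) (Fin 2) (Fin 2) (Fin 2) ⊂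
        LHS (Fin 2) (Fin 2) (Fin 2) (Fin 2) (Fin 2) ∩
          QuantumRealizable (Fin 2) (Fin 2) (Fin 2) (Fin 2) (Fin 2)) ∧
    -- exposure: the GHZ assemblage is LHS but not TO-LHS, as the wiring `y = a` makes it steerable
    ((∀ a b x y : Fin 2, ghzAssemblage a b x y =
        (1 / 8 : ℝ) • (1 + ((-1 : ℝ) ^ (b : ℕ) / √2) •
          (pauliZ + (((x : ℕ) : ℝ) * (-1 : ℝ) ^ ((a : ℕ) + (y : ℕ))) • pauliX))) ∧
      ghzAssemblage ∈ QuantumRealizable (Fin 2) (Fin 2) (Fin 2) (Fin 2) (Fin 2) ∧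
      ghzAssemblage ∈ LHS (Fin 2) (Fin 2) (Fin 2) (Fin 2) (Fin 2) ∧
      (∀ b x : Fin 2, wired ghzAssemblage b x =
        (1 / 4 : ℝ) • (1 + ((-1 : ℝ) ^ (b : ℕ) / √2) •
          (pauliZ + ((x : ℕ) : ℝ) • pauliX))) ∧
      IsSteerable (wired ghzAssemblage) ∧
      ghzAssemblage ∉ TOLHS (Fin 2) (Fin 2) (Fin 2) (Fin 2) (Fin 2)) ∧
    -- the noisy W assemblage is quantum-realizable; it is TO-LHS up to visibility 0.64 ...
    (∀ v : ℝ, 0 ≤ v → v ≤ 1 → noisyWAssemblage 0.97177 v ∈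
      QuantumRealizable (Fin 2) (Fin 2) (Fin 2) (Fin 2) (Fin 2)) ∧
    (∀ v : ℝ, 0 ≤ v → v ≤ 0.64 → noisyWAssemblage 0.97177 v ∈
      TOLHS (Fin 2) (Fin 2) (Fin 2) (Fin 2) (Fin 2)) ∧
    -- ... and from visibility 0.64 on it violates an NS-LHS witness and certifies entanglement
    (∃ W : Family (Fin 2) (Fin 2) (Fin 2) (Fin 2) (Fin 2),
      (∀ a b x y, (W a b x y).IsHermitian) ∧
      (∀ σ ∈ NSLHS (Fin 2) (Fin 2) (Fin 2) (Fin 2) (Fin 2),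
        -1 ≤ witnessValue W σ ∧ witnessValue W σ ≤ 0) ∧
      ∀ v : ℝ, 0.64 ≤ v → v ≤ 1 → 0 < witnessValue W (noisyWAssemblage 0.97177 v)) ∧
    (∀ v : ℝ, 0.64 ≤ v → v ≤ 1 →
      noisyWAssemblage 0.97177 v ∉ NSLHS (Fin 2) (Fin 2) (Fin 2) (Fin 2) (Fin 2) ∧
      CertifiesEntanglement (noisyWAssemblage 0.97177 v)) := by
  refine ⟨fun A B X Y C _ _ _ => ⟨QLHS_subset_NSLHS, NSLHS_subset_TOLHS, TOLHS_subset_LHS⟩,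
    ⟨?_, ?_, ?_⟩, ⟨?_, ?_, ?_⟩, ⟨ghzAssemblage_eq, ghzAssemblage_mem_quantumRealizable,
      ghzAssemblage_mem_LHS, wired_ghzAssemblage_eq, isSteerable_wired_ghzAssemblage,
      ghzAssemblage_notMem_TOLHS⟩,
    fun v h0 h1 => noisyWAssemblage_mem_quantumRealizable (by norm_num) h0 h1,
    fun v h0 h1 => noisyWAssemblage_mem_TOLHS h0 h1,
    ⟨wWitness, isHermitian_wWitness, fun σ hσ => witnessValue_wWitness_mem hσ,
      fun v h _ => witnessValue_wWitness_pos h⟩,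
    fun v h _ => ⟨noisyWAssemblage_notMem_NSLHS h, certifiesEntanglement_of_notMem_QLHS fun hq =>
      noisyWAssemblage_notMem_NSLHS h (QLHS_subset_NSLHS hq)⟩⟩
  · exact (Set.ssubset_iff_of_subset QLHS_subset_NSLHS).2
      ⟨_, merminAssemblage_mem_NSLHS, merminAssemblage_notMem_QLHS⟩
  · exact (Set.ssubset_iff_of_subset NSLHS_subset_TOLHS).2
      ⟨_, noisyWAssemblage_mem_TOLHS (by norm_num) le_rfl, noisyWAssemblage_notMem_NSLHS le_rfl⟩
  · exact (Set.ssubset_iff_of_subset TOLHS_subset_LHS).2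
      ⟨_, ghzAssemblage_mem_LHS, ghzAssemblage_notMem_TOLHS⟩
  · exact (Set.ssubset_iff_of_subset (Set.inter_subset_inter_left _ QLHS_subset_NSLHS)).2
      ⟨_, ⟨merminAssemblage_mem_NSLHS, merminAssemblage_mem_quantumRealizable⟩,
        fun h => merminAssemblage_notMem_QLHS h.1⟩
  · exact (Set.ssubset_iff_of_subset (Set.inter_subset_inter_left _ NSLHS_subset_TOLHS)).2
      ⟨_, ⟨noisyWAssemblage_mem_TOLHS (v := 0.64) (by norm_num) le_rfl,
        noisyWAssemblage_mem_quantumRealizable (by norm_num) (by norm_num) (by norm_num)⟩,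
        fun h => noisyWAssemblage_notMem_NSLHS le_rfl h.1⟩
  · exact (Set.ssubset_iff_of_subset (Set.inter_subset_inter_left _ TOLHS_subset_LHS)).2
      ⟨_, ⟨ghzAssemblage_mem_LHS, ghzAssemblage_mem_quantumRealizable⟩,
        fun h => ghzAssemblage_notMem_TOLHS h.1⟩
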